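/- Let $K$ be a field. For a set $X$ let $\langle X\rangle$ be the free abelian monoid on $X$. A \emph{basic Bergman presentation} $(X,R)$ consists of a finite set $X$ of generators and a finite family $R=\{a_i=b_i\mid i\in I\}$ of relations with $a_i,b_i\in\langle X\rangle\setminus\{0\}$ (it is a Bergman presentation, i.e. a finite abelian monoid presentation with nonzero sides and relations coloured blue or red subject to certain conditions, in which there are no blue relations). Its \emph{Bergman algebra} $B(X,R)$ is the unital $K$-algebra obtained from $K^X$ by adjoining, for every $i\in I$, a universal isomorphism between the finitely generated projective modules $P_{a_i}$ and $P_{b_i}$; here, if $e_x\in K^X$ is the unit vector of $x\in X$ and $c=x_1+\dots+x_n\in\langle X\rangle$, then $P_c=\bigoplus_{k}K^Xe_{x_k}$ is represented by the idempotent matrix $\epsilon_c=\operatorname{diag}(e_{x_1},\dots,e_{x_n})$. Explicitly, one adjoins to $K^X$ the entries of matrices $\sigma_i,\sigma_i'$ subject to $\epsilon_{a_i}\sigma_i\epsilon_{b_i}=\sigma_i$, $\epsilon_{b_i}\sigma_i'\epsilon_{a_i}=\sigma_i'$, $\sigma_i\sigma_i'=\epsilon_{a_i}$ and $\sigma_i'\sigma_i=\epsilon_{b_i}$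 for all $i\in I$. \textbf{Theorem.} (1) Let $(X,R)$ be a basic Bergman presentation, and let $x\in X$ and $i\in I$ be such that $a_i=x$ and $x$ is not a summand of $b_i$. For $j\in I\setminus\{i\}$ let $a_j'$ and $b_j'$ be obtained from $a_j$ and $b_j$ by replacing each occurrence of $x$ by $b_i$. Then $(X\setminus\{x\},\{a'_j=b'_j\mid j\in I\setminus\{i\}\})$ is a basic Bergman presentation whose Bergman algebra is Morita equivalent to $B(X,R)$. (2) Let $H$ be a basic Bergman graph, i.e. a finite set $H^0$ of vertices and a finite set $H^1$ of hyperedges together with nonempty source and range multisets $s(g),r(g):H^0\to\mathbb N_0$ for every $g\in H^1$ (no hyperedge being blue). Its Bergman algebra $B(H)$ is the Bergman algebra of the presentation with generators $H^0$ and relations $\sum_{u}s(g)(u)u=\sum_{u}r(g)(u)u$ $(g\in H^1)$. Let $v\in H^0$ and $h\in H^1$ be such that $s(h)=\{v\}$ (with multiplicity one) and $r(h)(v)=0$. Let $H'$ have vertex set $H^0\setminus\{v\}$, hyperedge set $H^1\setminus\{h\}$, and \[s'(g)(u)=s(g)(u)+s(g)(v)\,r(h)(u),\qquad r'(g)(u)=r(g)(u)+r(g)(v)\,r(h)(u).\]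 Then $H'$ is a basic Bergman graph, and $B(H')$ is Morita equivalent to $B(H)$. Here two $K$-algebras are called Morita equivalent if their categories of left modules are $K$-linearly equivalent; in particular they are then Morita equivalent as rings. -/

import Mathlib

universe u v w w'

noncomputable section

namespace Bergman

/-! ### Adjoining generators and relations to a `K`-algebra -/

section Adjoining

variable (K : Type u) [Field K]

/-- The relations which make the map from `A` to the free algebra on `A ⊕ G` a `K`-algebra
homomorphism. -/
inductive FreeExtRel (A : Type v) [Ring A] [Algebra K A] (G : Type w) :
    FreeAlgebra K (A ⊕ G) → FreeAlgebra K (A ⊕ G) → Prop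
  | add (r s : A) : FreeExtRel A G (FreeAlgebra.ι K (Sum.inl (r + s)))
      (FreeAlgebra.ι K (Sum.inl r) + FreeAlgebra.ι K (Sum.inl s))
  | mul (r s : A) : FreeExtRel A G (FreeAlgebra.ι K (Sum.inl (r * s)))
      (FreeAlgebra.ι K (Sum.inl r) * FreeAlgebra.ι K (Sum.inl s))
  | scalar (k : K) : FreeExtRel A G (FreeAlgebra.ι K (Sum.inl (algebraMap K A k)))
      (algebraMap K (FreeAlgebra K (A ⊕ G)) k)

/-- The free product of the `K`-algebra `A` and the free unital `K`-algebra on the set `G`. -/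
abbrev FreeExt (A : Type v) [Ring A] [Algebra K A] (G : Type w) : Type (max u v w) :=
  RingQuot (FreeExtRel K A G)

/-- The canonical map from `A` to the free product. -/
def FreeExt.base {A : Type v} [Ring A] [Algebra K A] (G : Type w) (r : A) : FreeExt K A G :=
  RingQuot.mkAlgHom K (FreeExtRel K A G) (FreeAlgebra.ι K (Sum.inl r))

/-- The adjoined generator `g`. -/
def FreeExt.gen (A : Type v) [Ring A] [Algebra K A] {G : Type w} (g : G) : FreeExt K A G :=
  RingQuot.mkAlgHom K (FreeExtRel K A G) (FreeAlgebra.ι K (Sum.inr g))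

end Adjoining

/-- A square matrix over `A` together with its finite index set. -/
structure SqMatrix (A : Type u) : Type (max u (v + 1)) where
  ι : Type v
  [fin : Fintype ι]
  mat : Matrix ι ι A

attribute [instance] SqMatrix.fin

/-- Given square matrices `ε x` (`x ∈ X`) and an element `c` of the free abelian monoid on `X`,
the block diagonal matrix `ε_c` which has one block `ε x` for each summand `x` of `c`. The pairs
`(x, k)` with `k < c x` label the summands of `c`. -/
def SqMatrix.ofSum {X : Type v} [Fintype X] [DecidableEq X] {A : Type u} [Ring A]
    (ε : X → SqMatrix.{u, v} A) (c : X →₀ ℕ) : SqMatrix.{u, v} A where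
  ι := Σ p : (Σ x : X, Fin (c x)), (ε p.1).ι
  mat := Matrix.blockDiagonal' fun p : (Σ x : X, Fin (c x)) => (ε p.1).mat

/-! ### The universal isomorphisms `A⟨[P_j] = [Q_j] (j ∈ J)⟩` -/

section UniversalIso

variable (K : Type u) [Field K] {A : Type v} [Ring A] [Algebra K A] {J : Type w'}

/-- The entries of the adjoined matrices `σ_j` (left) and `σ'_j` (right). -/
abbrev IsoGen (ζ η : J → SqMatrix.{v, w} A) : Type (max w w') :=
  Σ j : J, ((ζ j).ι × (η j).ι) ⊕ ((η j).ι × (ζ j).ι)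

variable (ζ η : J → SqMatrix.{v, w} A)

/-- The adjoined matrix `σ_j`. -/
def isoMat (j : J) : Matrix (ζ j).ι (η j).ι (FreeExt K A (IsoGen ζ η)) :=
  Matrix.of fun p q => FreeExt.gen K A ⟨j, Sum.inl (p, q)⟩

/-- The adjoined matrix `σ'_j`. -/
def isoMatInv (j : J) : Matrix (η j).ι (ζ j).ι (FreeExt K A (IsoGen ζ η)) :=
  Matrix.of fun q p => FreeExt.gen K A ⟨j, Sum.inr (q, p)⟩

/-- The matrix `ζ_j` over the free product. -/
def isoSource (j : J) : Matrix (ζ j).ι (ζ j).ι (FreeExt K A (IsoGen ζ η)) :=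
  (ζ j).mat.map (FreeExt.base K (IsoGen ζ η))

/-- The matrix `η_j` over the free product. -/
def isoTarget (j : J) : Matrix (η j).ι (η j).ι (FreeExt K A (IsoGen ζ η)) :=
  (η j).mat.map (FreeExt.base K (IsoGen ζ η))

/-- The relations `ζση = σ`, `ησ'ζ = σ'`, `σσ' = ζ`, `σ'σ = η`, entry by entry. -/
inductive IsoRel : FreeExt K A (IsoGen ζ η) → FreeExt K A (IsoGen ζ η) → Prop
  | corner (j : J) (p : (ζ j).ι) (q : (η j).ι) :
      IsoRel ((isoSource K ζ η j * isoMat K ζ η j * isoTarget K ζ η j) p q)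
        (isoMat K ζ η j p q)
  | cornerInv (j : J) (q : (η j).ι) (p : (ζ j).ι) :
      IsoRel ((isoTarget K ζ η j * isoMatInv K ζ η j * isoSource K ζ η j) q p)
        (isoMatInv K ζ η j q p)
  | mulInv (j : J) (p p' : (ζ j).ι) :
      IsoRel ((isoMat K ζ η j * isoMatInv K ζ η j) p p') (isoSource K ζ η j p p')
  | invMul (j : J) (q q' : (η j).ι) :
      IsoRel ((isoMatInv K ζ η j * isoMat K ζ η j) q q') (isoTarget K ζ η j q q')

/-- If `ζ_j` and `η_j` are idempotent matrices representing the finitely generated projective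
`A`-modules `P_j` and `Q_j`, this is the `K`-algebra obtained from `A` by adjoining, for all `j`
at once, a universal isomorphism between the modules induced by `P_j` and `Q_j`. -/
abbrev IsoExt : Type (max u v w w') := RingQuot (IsoRel K ζ η)

end UniversalIso

/-! ### The universal decomposition `A⟨[P_x] (x ∈ S) | [P] = ∑ [P_x]⟩` -/

section UniversalSum

variable (K : Type u) [Field K] {A : Type v} [Ring A] [Algebra K A] {X : Type w}

/-- The entries of the adjoined matrices `ε_x` (`x ∈ S`). -/
abbrev SumGen (S : Finset X) (ζ : SqMatrix.{v, w} A) : Type w := S × ζ.ι × ζ.ι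

variable (S : Finset X) (ζ : SqMatrix.{v, w} A)

/-- The adjoined matrix `ε_x`. -/
def sumMat (x : S) : Matrix ζ.ι ζ.ι (FreeExt K A (SumGen S ζ)) :=
  Matrix.of fun p q => FreeExt.gen K A (x, p, q)

/-- The matrix `ζ` over the free product. -/
def sumSource : Matrix ζ.ι ζ.ι (FreeExt K A (SumGen S ζ)) :=
  ζ.mat.map (FreeExt.base K (SumGen S ζ))

/-- The relations `ζ ε_x ζ = ε_x`, `ε_x ε_x = ε_x`, `ε_x ε_y = 0` for `x ≠ y`, and `∑ ε_x = ζ`,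
entry by entry. (The last relation expresses one of the `ε_x` through the other ones; the relations
which involve this one follow from those between the others.) -/
inductive SumRel : FreeExt K A (SumGen S ζ) → FreeExt K A (SumGen S ζ) → Prop
  | corner (x : S) (p q : ζ.ι) :
      SumRel ((sumSource K S ζ * sumMat K S ζ x * sumSource K S ζ) p q) (sumMat K S ζ x p q)
  | idem (x : S) (p q : ζ.ι) :
      SumRel ((sumMat K S ζ x * sumMat K S ζ x) p q) (sumMat K S ζ x p q)
  | orth (x y : S) (hxy : x ≠ y) (p q : ζ.ι) :
      SumRel ((sumMat K S ζ x * sumMat K S ζ y) p q) 0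
  | total (p q : ζ.ι) : SumRel ((∑ x : S, sumMat K S ζ x) p q) (sumSource K S ζ p q)

/-- If `ζ` is an idempotent matrix representing the finitely generated projective `A`-module `P`,
this is the `K`-algebra obtained from `A` by adjoining a universal direct sum decomposition,
with summands indexed by `S`, of the module induced by `P`. -/
abbrev SumExt : Type (max u v w) := RingQuot (SumRel K S ζ)

end UniversalSum

/-! ### Bergman presentations -/

/-- `BaseGen b blue` is the set of elements that lie in no `supp (b i)` with `i` blue. -/
def BaseGen {X : Type v} {I : Type w} (b : I → X → ℕ) (blue : Set I) : Set X :=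
  {x | ∀ i ∈ blue, b i x = 0}

/-- The list `l` is an admissible ordering of the set `blue`, for relations `a i = b i`: each
summand of the left hand side of a blue relation is a base generator or a summand of the right hand
side of an earlier blue relation. -/
def IsAdmissible {X : Type v} {I : Type w} (a b : I → X → ℕ) (blue : Set I) (l : List I) : Prop :=
  l.Nodup ∧ (∀ i, i ∈ l ↔ i ∈ blue) ∧
    ∀ (k : ℕ) (hk : k < l.length) (x : X), a l[k] x ≠ 0 →
      x ∈ BaseGen b blue ∨ ∃ (p : ℕ) (hp : p < k), b (l[p]'(hp.trans hk)) x ≠ 0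

/-- A Bergman presentation with (finite) set of generators `X` and relations `a i = b i` indexed
by the (finite) set `I`. The relations which are not blue are red. -/
structure BergmanPresentation (X : Type v) (I : Type w) where
  a : I → X →₀ ℕ
  b : I → X →₀ ℕ
  blue : Set I
  a_ne_zero : ∀ i, a i ≠ 0
  b_ne_zero : ∀ i, b i ≠ 0
  /-- `b i` is the sum of the elements of a set `X_i`, -/
  blue_eq_sum : ∀ i ∈ blue, b i = ∑ x ∈ (b i).support, Finsupp.single x 1
  /-- where `X_i` has at least two elements, -/
  blue_two_le : ∀ i ∈ blue, 2 ≤ (b i).support.card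
  /-- and the sets `X_i` are pairwise disjoint. -/
  blue_disjoint : blue.Pairwise fun i j => Disjoint (b i).support (b j).support
  exists_admissible : ∃ l : List I, IsAdmissible (fun i => ⇑(a i)) (fun i => ⇑(b i)) blue l

namespace BergmanPresentation

variable {X : Type v} {I : Type w}

/-- The set of base generators. -/
def base (P : BergmanPresentation X I) : Set X := BaseGen (fun i => ⇑(P.b i)) P.blue

/-- All generators are base generators. -/
def IsBasic (P : BergmanPresentation X I) : Prop := P.base = Set.univ

/-- A chosen admissible ordering of the blue relations. -/
def ordering (P : BergmanPresentation X I) : List I := P.exists_admissible.choose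

end BergmanPresentation

/-! ### Bergman algebras -/

/-- A stage in the construction of a Bergman algebra: a `K`-algebra `A` and, for every generator
`x` that has already been adjoined, a matrix `ε x` over `A` representing the corresponding
projective module (for the other generators, a `0 × 0` matrix). -/
structure Stage (K : Type u) [Field K] (X : Type v) : Type (max u v + 1) where
  A : Type (max u v)
  [ring : Ring A]
  [algebra : Algebra K A]
  ε : X → SqMatrix.{max u v, v} A

attribute [instance] Stage.ring Stage.algebra

namespace BergmanPresentation

variable (K : Type u) [Field K] {X : Type v} [Fintype X] [DecidableEq X] {I : Type w}

open Classical in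
/-- The algebra `K^{X_base}`, where the base generator `x` is represented by the `1 × 1` matrix
whose entry is the corresponding unit vector. -/
def initialStage (P : BergmanPresentation X I) : Stage K X where
  A := P.base → K
  ε x := if h : x ∈ P.base then ⟨PUnit, fun _ _ => Pi.single ⟨x, h⟩ 1⟩ else ⟨PEmpty, 0⟩

open Classical in
/-- Adjoining the generators `x ∈ X_i` and the blue relation `a i = ∑_{x ∈ X_i} x`. -/
def blueStep (P : BergmanPresentation X I) (T : Stage K X) (i : I) : Stage K X where
  A := SumExt K (P.b i).support (SqMatrix.ofSum T.ε (P.a i))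
  ε x :=
    if h : x ∈ (P.b i).support then
      ⟨(SqMatrix.ofSum T.ε (P.a i)).ι,
        (sumMat K (P.b i).support (SqMatrix.ofSum T.ε (P.a i)) ⟨x, h⟩).map
          (RingQuot.mkAlgHom K (SumRel K (P.b i).support (SqMatrix.ofSum T.ε (P.a i))))⟩
    else
      ⟨(T.ε x).ι, (T.ε x).mat.map fun r =>
        RingQuot.mkAlgHom K (SumRel K (P.b i).support (SqMatrix.ofSum T.ε (P.a i)))
          (FreeExt.base K _ r)⟩

/-- The stage reached when the blue relations in the list `l` have been adjoined in this order. -/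
def blueStage (P : BergmanPresentation X I) (l : List I) : Stage K X :=
  l.foldl (P.blueStep K) (P.initialStage K)

/-- Adjoining all red relations to the stage `T`. -/
abbrev redAlgebra (P : BergmanPresentation X I) (T : Stage K X) : Type (max u v w) :=
  IsoExt K (fun j : {i : I // i ∉ P.blue} => SqMatrix.ofSum T.ε (P.a j))
    (fun j : {i : I // i ∉ P.blue} => SqMatrix.ofSum T.ε (P.b j))

/-- The Bergman algebra `B(X, R)`. -/
abbrev algebra (P : BergmanPresentation X I) : Type (max u v w) :=
  P.redAlgebra K (P.blueStage K P.ordering)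

end BergmanPresentation

/-! ### Collapsing a Bergman presentation -/

section Substitution

variable {X : Type v} [DecidableEq X]

/-- The element obtained from `c` by replacing any occurrence of the generator `x` by `b`. -/
def substitute (x : X) (b c : X →₀ ℕ) : X →₀ ℕ :=
  c.sum fun y n => n • if y = x then b else Finsupp.single y 1

theorem substitute_apply_of_ne (x : X) (b c : X →₀ ℕ) {u : X} (hu : u ≠ x) :
    substitute x b c u = c u + c x * b u := by
  have key : ∀ y ∈ c.support, (c y • if y = x then b else Finsupp.single y 1) u =
      (if y = u then c y else 0) + (if y = x then c y * b u else 0) := by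
    intro y _
    by_cases hyx : y = x
    · subst hyx
      simp [Ne.symm hu]
    · simp [hyx, Finsupp.single_apply]
  rw [substitute, Finsupp.sum, Finsupp.finsetSum_apply, Finset.sum_congr rfl key,
    Finset.sum_add_distrib, Finset.sum_ite_eq', Finset.sum_ite_eq']
  by_cases h1 : c u = 0 <;> by_cases h2 : c x = 0 <;> simp [h1, h2]

/-- If `x` is not a summand of `b`, it is not a summand of the result of the replacement. -/
theorem substitute_apply_self (x : X) (b c : X →₀ ℕ) (hb : b x = 0) :
    substitute x b c x = 0 := by
  rw [substitute, Finsupp.sum, Finsupp.finsetSum_apply]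
  refine Finset.sum_eq_zero fun y _ => ?_
  by_cases hyx : y = x
  · simp [hyx, hb]
  · simp [hyx]

/-- The replacement as an element of the free abelian monoid on `X \ {x}`. -/
def collapseSum (x : X) (b c : X →₀ ℕ) : {y : X // y ≠ x} →₀ ℕ :=
  (substitute x b c).subtypeDomain fun y => y ≠ x

theorem collapseSum_ne_zero (x : X) {b c : X →₀ ℕ} (hb : b ≠ 0) (hbx : b x = 0) (hc : c ≠ 0) :
    collapseSum x b c ≠ 0 := by
  intro h
  have key : ∀ u, u ≠ x → c u + c x * b u = 0 := fun u hu =>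
    (substitute_apply_of_ne x b c hu).symm.trans (DFunLike.congr_fun h ⟨u, hu⟩)
  obtain ⟨z, hz⟩ := Finsupp.ne_iff.1 hb
  have hzx : z ≠ x := fun e => hz (by simp [e, hbx])
  have hcx : c x = 0 := by
    have := key z hzx
    simp only [Nat.add_eq_zero_iff, mul_eq_zero] at this
    exact this.2.resolve_right hz
  refine hc (Finsupp.ext fun u => ?_)
  by_cases hu : u = x
  · simpa [hu] using hcx
  · have := key u hu
    simp only [Finsupp.coe_zero, Pi.zero_apply]
    omega

end Substitution

namespace BergmanPresentation

variable {X : Type v} {I : Type w}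

theorem IsBasic.blue_eq_empty {P : BergmanPresentation X I} (hP : P.IsBasic) : P.blue = ∅ := by
  refine Set.eq_empty_iff_forall_notMem.2 fun i hi => P.b_ne_zero i (Finsupp.ext fun x => ?_)
  have hx : x ∈ P.base := hP ▸ Set.mem_univ x
  exact hx i hi

/-- Collapsing a basic presentation with `i`-th relation `x = b i`, where `x` is not a summand of
`b i`: the generator `x` and the `i`-th relation are removed, and in all other relations any
occurrence of `x` is replaced by `b i`. (The hypothesis `P.a i = x` is not needed for the
construction to make sense.) -/
def collapse [DecidableEq X] (P : BergmanPresentation X I) (hP : P.IsBasic) (x : X) (i : I)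
    (hx : P.b i x = 0) : BergmanPresentation {y : X // y ≠ x} {j : I // j ≠ i} where
  a j := collapseSum x (P.b i) (P.a j)
  b j := collapseSum x (P.b i) (P.b j)
  blue := {j | j.1 ∈ P.blue}
  a_ne_zero j := collapseSum_ne_zero x (P.b_ne_zero i) hx (P.a_ne_zero j)
  b_ne_zero j := collapseSum_ne_zero x (P.b_ne_zero i) hx (P.b_ne_zero j)
  blue_eq_sum j hj := by simp [hP.blue_eq_empty] at hj
  blue_two_le j hj := by simp [hP.blue_eq_empty] at hj
  blue_disjoint j hj := by simp [hP.blue_eq_empty] at hj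
  exists_admissible := ⟨[], by simp [IsAdmissible, hP.blue_eq_empty]⟩

end BergmanPresentation

/-! ### Bergman graphs -/

/-- A Bergman graph with (finite) vertex set `V` and (finite) set of hyperedges `E`. Multisets over
`V` are maps `V → ℕ`. The hyperedges which are not blue are red. -/
structure BergmanGraph (V : Type v) (E : Type w) where
  s : E → V → ℕ
  r : E → V → ℕ
  blue : Set E
  s_ne_zero : ∀ h, s h ≠ 0
  r_ne_zero : ∀ h, r h ≠ 0
  /-- The range multiset of a blue hyperedge is a set -/
  blue_le_one : ∀ h ∈ blue, ∀ v, r h v ≤ 1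
  /-- with at least two elements, -/
  blue_two_le : ∀ h ∈ blue, ∃ v v', v ≠ v' ∧ r h v ≠ 0 ∧ r h v' ≠ 0
  /-- and these sets are pairwise disjoint. -/
  blue_disjoint : blue.Pairwise fun h g => ∀ v, r h v = 0 ∨ r g v = 0
  exists_admissible : ∃ l : List E, IsAdmissible s r blue l

namespace BergmanGraph

variable {V : Type v} {E : Type w}

/-- All vertices are base vertices, i.e. no vertex is a range of a blue hyperedge. -/
def IsBasic (H : BergmanGraph V E) : Prop := BaseGen H.r H.blue = Set.univ

/-- The Bergman presentation that corresponds to a Bergman graph: its generators are the vertices,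
and each hyperedge `h` gives the relation `∑ s(h) = ∑ r(h)` of the same colour. -/
def toPresentation [Fintype V] (H : BergmanGraph V E) : BergmanPresentation V E where
  a h := Finsupp.equivFunOnFinite.symm (H.s h)
  b h := Finsupp.equivFunOnFinite.symm (H.r h)
  blue := H.blue
  a_ne_zero h h0 := H.s_ne_zero h (funext fun v => DFunLike.congr_fun h0 v)
  b_ne_zero h h0 := H.r_ne_zero h (funext fun v => DFunLike.congr_fun h0 v)
  blue_eq_sum h hh := by
    classical
    ext v
    have h1 := H.blue_le_one h hh v
    by_cases h0 : H.r h v = 0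
    · simp [Finsupp.finsetSum_apply, Finsupp.single_apply, h0]
    · have h2 : H.r h v = 1 := by omega
      simp [Finsupp.finsetSum_apply, Finsupp.single_apply, h2]
  blue_two_le h hh := by
    obtain ⟨v, v', hne, hv, hv'⟩ := H.blue_two_le h hh
    exact Finset.one_lt_card.2 ⟨v, by simpa using hv, v', by simpa using hv', hne⟩
  blue_disjoint h hh g hg hne := by
    refine Finset.disjoint_left.2 fun v hv hv' => ?_
    have h1 := H.blue_disjoint hh hg hne v
    simp only [Finsupp.mem_support_iff, Finsupp.equivFunOnFinite_symm_apply_apply] at hv hv'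
    exact h1.elim hv hv'
  exists_admissible := H.exists_admissible

/-- The Bergman algebra `B(H)`. -/
abbrev algebra (K : Type u) [Field K] [Fintype V] [DecidableEq V] (H : BergmanGraph V E) :
    Type (max u v w) :=
  H.toPresentation.algebra K

theorem IsBasic.blue_eq_empty {H : BergmanGraph V E} (hH : H.IsBasic) : H.blue = ∅ := by
  refine Set.eq_empty_iff_forall_notMem.2 fun h hh => H.r_ne_zero h (funext fun v => ?_)
  have hv : v ∈ BaseGen H.r H.blue := hH ▸ Set.mem_univ v
  exact hv h hh

theorem collapse_ne_zero {v : V} {m n : V → ℕ} (hm : m ≠ 0) (hmv : m v = 0) (hn : n ≠ 0) :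
    (fun u : {u : V // u ≠ v} => n u + n v * m u) ≠ 0 := by
  intro h
  obtain ⟨z, hz⟩ := Function.ne_iff.1 hm
  have hzv : z ≠ v := fun e => hz (by simp [e, hmv])
  have hnv : n v = 0 := by
    have := congr_fun h ⟨z, hzv⟩
    simp only [Pi.zero_apply, Nat.add_eq_zero_iff, mul_eq_zero] at this
    exact this.2.resolve_right hz
  refine hn (funext fun u => ?_)
  by_cases hu : u = v
  · simpa [hu] using hnv
  · have := congr_fun h ⟨u, hu⟩
    simp only [Pi.zero_apply] at this ⊢
    omega

/-- Collapsing a basic Bergman graph with hyperedge `h` such that `s h = {v}` and `v` is not a range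
of `h`: the vertex `v` and the hyperedge `h` are removed, and in the sources and ranges of the
other hyperedges each occurrence of `v` is replaced by the multiset `r h`. (The hypothesis
`s h = {v}` is not needed for the construction to make sense.) -/
def collapse (H : BergmanGraph V E) (hH : H.IsBasic) (v : V) (h : E) (hv : H.r h v = 0) :
    BergmanGraph {u : V // u ≠ v} {g : E // g ≠ h} where
  s g u := H.s g u + H.s g v * H.r h u
  r g u := H.r g u + H.r g v * H.r h u
  blue := {g | g.1 ∈ H.blue}
  s_ne_zero g := collapse_ne_zero (H.r_ne_zero h) hv (H.s_ne_zero g)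
  r_ne_zero g := collapse_ne_zero (H.r_ne_zero h) hv (H.r_ne_zero g)
  blue_le_one g hg := by simp [hH.blue_eq_empty] at hg
  blue_two_le g hg := by simp [hH.blue_eq_empty] at hg
  blue_disjoint g hg := by simp [hH.blue_eq_empty] at hg
  exists_admissible := ⟨[], by simp [IsAdmissible, hH.blue_eq_empty]⟩

end BergmanGraph

end Bergman

end

noncomputable section

namespace Bergman

open CategoryTheory

universe t

/-! ### Universal properties of the algebras obtained by adjoining generators and relations -/

section FreeExtLift

variable (K : Type u) [Field K] {A : Type v} [Ring A] [Algebra K A] (G : Type w)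

/-- The canonical map from `A` to the free product as a homomorphism of algebras. -/
def FreeExt.baseHom : A →ₐ[K] FreeExt K A G where
  toFun := FreeExt.base K G
  map_one' := by
    have h := RingQuot.mkAlgHom_rel K (FreeExtRel.scalar (K := K) (A := A) (G := G) 1)
    simp only [map_one] at h
    exact h
  map_mul' r s := by
    have h := RingQuot.mkAlgHom_rel K (FreeExtRel.mul (K := K) (G := G) r s)
    simp only [map_mul] at h
    exact h
  map_zero' := by
    have h := RingQuot.mkAlgHom_rel K (FreeExtRel.scalar (K := K) (A := A) (G := G) 0)
    simp only [map_zero] at h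
    exact h
  map_add' r s := by
    have h := RingQuot.mkAlgHom_rel K (FreeExtRel.add (K := K) (G := G) r s)
    simp only [map_add] at h
    exact h
  commutes' k := by
    have h := RingQuot.mkAlgHom_rel K (FreeExtRel.scalar (K := K) (A := A) (G := G) k)
    simp only [AlgHom.commutes] at h
    exact h

variable {G} {C : Type w'} [Ring C] [Algebra K C]

/-- The universal property of the free product. -/
def FreeExt.lift (f : A →ₐ[K] C) (t : G → C) : FreeExt K A G →ₐ[K] C :=
  RingQuot.liftAlgHom K ⟨FreeAlgebra.lift K (Sum.elim f t), by
    intro a b h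
    cases h <;> simp⟩

@[simp]
theorem FreeExt.lift_base (f : A →ₐ[K] C) (t : G → C) (a : A) :
    FreeExt.lift K f t (FreeExt.base K G a) = f a := by
  simp [FreeExt.lift, FreeExt.base]

@[simp]
theorem FreeExt.lift_gen (f : A →ₐ[K] C) (t : G → C) (g : G) :
    FreeExt.lift K f t (FreeExt.gen K A g) = t g := by
  simp [FreeExt.lift, FreeExt.gen]

theorem FreeExt.eq_top (S : Subalgebra K (FreeExt K A G)) (hb : ∀ a, FreeExt.base K G a ∈ S)
    (hg : ∀ g, FreeExt.gen K A g ∈ S) : S = ⊤ := by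
  have h : S.comap (RingQuot.mkAlgHom K (FreeExtRel K A G)) = ⊤ := by
    rw [← top_le_iff, ← FreeAlgebra.adjoin_range_ι, Algebra.adjoin_le_iff]
    rintro _ ⟨a | g, rfl⟩
    exacts [hb a, hg g]
  refine eq_top_iff.2 fun z _ => ?_
  obtain ⟨y, rfl⟩ := RingQuot.mkAlgHom_surjective K (FreeExtRel K A G) z
  have : y ∈ S.comap (RingQuot.mkAlgHom K (FreeExtRel K A G)) := h ▸ Algebra.mem_top
  exact this

end FreeExtLift

/-! ### Systems of isomorphisms -/

section System

variable {X : Type v} {J : Type w} {ι κ : J → Type v} [∀ j, Fintype (ι j)] [∀ j, Fintype (κ j)]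
  [Fintype X]

/-- Orthogonal idempotents `e x` with sum `1` in the ring `C`, together with mutually inverse
isomorphisms between the modules represented by the diagonal matrices with entries `e (p j k)` and
`e (q j l)`. -/
structure IsoSystem (p : ∀ j, ι j → X) (q : ∀ j, κ j → X) (C : Type*) [Ring C] where
  e : X → C
  s : ∀ j, ι j → κ j → C
  t : ∀ j, κ j → ι j → C
  idem : ∀ x, e x * e x = e x
  orth : ∀ x y, x ≠ y → e x * e y = 0
  sum_e : ∑ x, e x = 1
  corner_s : ∀ j k l, e (p j k) * s j k l * e (q j l) = s j k l
  corner_t : ∀ j l k, e (q j l) * t j l k * e (p j k) = t j l k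
  s_mul_t : ∀ j k, ∑ l, s j k l * t j l k = e (p j k)
  s_mul_t_ne : ∀ j k k', k ≠ k' → ∑ l, s j k l * t j l k' = 0
  t_mul_s : ∀ j l, ∑ k, t j l k * s j k l = e (q j l)
  t_mul_s_ne : ∀ j l l', l ≠ l' → ∑ k, t j l k * s j k l' = 0

namespace IsoSystem

variable {p : ∀ j, ι j → X} {q : ∀ j, κ j → X}

/-- The system `D` in the `K`-algebra `B` is universal: it generates `B`, and it is mapped to any
other system by some homomorphism of `K`-algebras. -/
structure IsUniversal (K : Type u) [Field K] {B : Type*} [Ring B] [Algebra K B]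
    (D : IsoSystem p q B) : Prop where
  eq_top : ∀ S : Subalgebra K B, (∀ x, D.e x ∈ S) → (∀ j k l, D.s j k l ∈ S) →
    (∀ j l k, D.t j l k ∈ S) → S = ⊤
  exists_lift : ∀ (C : Type max u v w) [Ring C] [Algebra K C] (E : IsoSystem p q C),
    ∃ f : B →ₐ[K] C, (∀ x, f (D.e x) = E.e x) ∧ (∀ j k l, f (D.s j k l) = E.s j k l) ∧
      ∀ j l k, f (D.t j l k) = E.t j l k

end IsoSystem

end System

section IsoExtUniversal

variable (K : Type u) [Field K] {A : Type v} [Ring A] [Algebra K A] {J : Type w'}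
  (ζ η : J → SqMatrix.{v, w} A)

/-- The canonical map from `A` to the algebra with universal isomorphisms. -/
def IsoExt.baseHom : A →ₐ[K] IsoExt K ζ η :=
  (RingQuot.mkAlgHom K (IsoRel K ζ η)).comp (FreeExt.baseHom K (IsoGen ζ η))

/-- The image of the matrix `σ_j`. -/
def IsoExt.mat (j : J) (k : (ζ j).ι) (l : (η j).ι) : IsoExt K ζ η :=
  RingQuot.mkAlgHom K (IsoRel K ζ η) (FreeExt.gen K A ⟨j, Sum.inl (k, l)⟩)

/-- The image of the matrix `σ'_j`. -/
def IsoExt.matInv (j : J) (l : (η j).ι) (k : (ζ j).ι) : IsoExt K ζ η :=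
  RingQuot.mkAlgHom K (IsoRel K ζ η) (FreeExt.gen K A ⟨j, Sum.inr (l, k)⟩)

variable {ζ η}

theorem IsoExt.corner (j : J) (k : (ζ j).ι) (l : (η j).ι) :
    ∑ l', (∑ k', baseHom K ζ η ((ζ j).mat k k') * mat K ζ η j k' l') *
      baseHom K ζ η ((η j).mat l' l) = mat K ζ η j k l := by
  have h := RingQuot.mkAlgHom_rel K (IsoRel.corner (K := K) (ζ := ζ) (η := η) j k l)
  simp only [Matrix.mul_apply, map_sum, map_mul] at h
  exact h

theorem IsoExt.cornerInv (j : J) (l : (η j).ι) (k : (ζ j).ι) :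
    ∑ k', (∑ l', baseHom K ζ η ((η j).mat l l') * matInv K ζ η j l' k') *
      baseHom K ζ η ((ζ j).mat k' k) = matInv K ζ η j l k := by
  have h := RingQuot.mkAlgHom_rel K (IsoRel.cornerInv (K := K) (ζ := ζ) (η := η) j l k)
  simp only [Matrix.mul_apply, map_sum, map_mul] at h
  exact h

theorem IsoExt.mat_mul_matInv (j : J) (k k' : (ζ j).ι) :
    ∑ l, mat K ζ η j k l * matInv K ζ η j l k' = baseHom K ζ η ((ζ j).mat k k') := by
  have h := RingQuot.mkAlgHom_rel K (IsoRel.mulInv (K := K) (ζ := ζ) (η := η) j k k')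
  simp only [Matrix.mul_apply, map_sum, map_mul] at h
  exact h

theorem IsoExt.matInv_mul_mat (j : J) (l l' : (η j).ι) :
    ∑ k, matInv K ζ η j l k * mat K ζ η j k l' = baseHom K ζ η ((η j).mat l l') := by
  have h := RingQuot.mkAlgHom_rel K (IsoRel.invMul (K := K) (ζ := ζ) (η := η) j l l')
  simp only [Matrix.mul_apply, map_sum, map_mul] at h
  exact h

theorem IsoExt.eq_top (S : Subalgebra K (IsoExt K ζ η)) (hb : ∀ a, baseHom K ζ η a ∈ S)
    (hs : ∀ j k l, mat K ζ η j k l ∈ S) (ht : ∀ j l k, matInv K ζ η j l k ∈ S) : S = ⊤ := by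
  have h : S.comap (RingQuot.mkAlgHom K (IsoRel K ζ η)) = ⊤ := by
    refine FreeExt.eq_top K _ hb ?_
    rintro ⟨j, ⟨k, l⟩ | ⟨l, k⟩⟩
    exacts [hs j k l, ht j l k]
  refine eq_top_iff.2 fun z _ => ?_
  obtain ⟨y, rfl⟩ := RingQuot.mkAlgHom_surjective K (IsoRel K ζ η) z
  have : y ∈ S.comap (RingQuot.mkAlgHom K (IsoRel K ζ η)) := h ▸ Algebra.mem_top
  exact this

theorem IsoExt.exists_lift {C : Type*} [Ring C] [Algebra K C] (f : A →ₐ[K] C)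
    (s : ∀ j, (ζ j).ι → (η j).ι → C) (t : ∀ j, (η j).ι → (ζ j).ι → C)
    (h1 : ∀ j k l, ∑ l', (∑ k', f ((ζ j).mat k k') * s j k' l') * f ((η j).mat l' l) = s j k l)
    (h2 : ∀ j l k, ∑ k', (∑ l', f ((η j).mat l l') * t j l' k') * f ((ζ j).mat k' k) = t j l k)
    (h3 : ∀ j k k', ∑ l, s j k l * t j l k' = f ((ζ j).mat k k'))
    (h4 : ∀ j l l', ∑ k, t j l k * s j k l' = f ((η j).mat l l')) :
    ∃ g : IsoExt K ζ η →ₐ[K] C, (∀ a, g (baseHom K ζ η a) = f a) ∧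
      (∀ j k l, g (mat K ζ η j k l) = s j k l) ∧ ∀ j l k, g (matInv K ζ η j l k) = t j l k := by
  let F : FreeExt K A (IsoGen ζ η) →ₐ[K] C := FreeExt.lift K f fun g =>
    match g with
    | ⟨j, Sum.inl (k, l)⟩ => s j k l
    | ⟨j, Sum.inr (l, k)⟩ => t j l k
  have hF : ∀ ⦃a b⦄, IsoRel K ζ η a b → F a = F b := by
    intro a b h
    cases h with
    | corner j k l =>
      simpa [F, Matrix.mul_apply, isoSource, isoTarget, isoMat] using h1 j k l
    | cornerInv j l k =>
      simpa [F, Matrix.mul_apply, isoSource, isoTarget, isoMatInv] using h2 j l k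
    | mulInv j k k' =>
      simpa [F, Matrix.mul_apply, isoSource, isoMat, isoMatInv] using h3 j k k'
    | invMul j l l' =>
      simpa [F, Matrix.mul_apply, isoTarget, isoMat, isoMatInv] using h4 j l l'
  refine ⟨RingQuot.liftAlgHom K ⟨F, hF⟩, fun a => ?_, fun j k l => ?_, fun j l k => ?_⟩
  · exact (RingQuot.liftAlgHom_mkAlgHom_apply K F hF _).trans (FreeExt.lift_base K f _ a)
  · simp [mat, F]
  · simp [matInv, F]

end IsoExtUniversal

section UniversalSystem

variable (K : Type u) [Field K]

/-- If `A` is the universal `K`-algebra with orthogonal idempotents `a x` with sum `1`, and if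
the matrices `ζ i` and `η i` are, up to a reindexing, the diagonal matrices with entries `a (p i k)`
and `a (q i l)`, then `IsoExt K ζ η` carries a universal system. -/
theorem IsoExt.exists_isUniversal {X : Type v} {I : Type w} [Fintype X] {A : Type w'} [Ring A]
    [Algebra K A]
    (a : X → A) (idem : ∀ x, a x * a x = a x) (orth : ∀ x y, x ≠ y → a x * a y = 0)
    (sum_a : ∑ x, a x = 1) (gen : ∀ S : Subalgebra K A, (∀ x, a x ∈ S) → S = ⊤)
    (lift : ∀ (C : Type max u v w) [Ring C] [Algebra K C] (c : X → C), (∀ x, c x * c x = c x) →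
      (∀ x y, x ≠ y → c x * c y = 0) → ∑ x, c x = 1 → ∃ f : A →ₐ[K] C, ∀ x, f (a x) = c x)
    (S : Set I) (hS : ∀ i, i ∉ S) (ζ η : I → SqMatrix.{w', v} A) {ι κ : I → Type v}
    [∀ i, Fintype (ι i)] [∀ i, Fintype (κ i)] (p : ∀ i, ι i → X) (q : ∀ i, κ i → X)
    (α : ∀ i, ι i ≃ (ζ i).ι) (β : ∀ i, κ i ≃ (η i).ι)
    (hζ : ∀ i k, (ζ i).mat (α i k) (α i k) = a (p i k))
    (hζ' : ∀ i k k', k ≠ k' → (ζ i).mat (α i k) (α i k') = 0)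
    (hη : ∀ i l, (η i).mat (β i l) (β i l) = a (q i l))
    (hη' : ∀ i l l', l ≠ l' → (η i).mat (β i l) (β i l') = 0) :
    ∃ D : IsoSystem p q (IsoExt K (fun i : {i // i ∉ S} => ζ i) (fun i : {i // i ∉ S} => η i)),
      D.IsUniversal K := by
  classical
  have hζm : ∀ i k k', (ζ i).mat (α i k) (α i k') = if k = k' then a (p i k) else 0 := by
    intro i k k'
    split_ifs with h
    · rw [← h, hζ]
    · exact hζ' i k k' h
  have hηm : ∀ i k k', (η i).mat (β i k) (β i k') = if k = k' then a (q i k) else 0 := by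
    intro i k k'
    split_ifs with h
    · rw [← h, hη]
    · exact hη' i k k' h
  set ζ₁ : {i // i ∉ S} → SqMatrix A := fun i => ζ i
  set η₁ : {i // i ∉ S} → SqMatrix A := fun i => η i
  let b : A →ₐ[K] IsoExt K ζ₁ η₁ := baseHom K ζ₁ η₁
  refine ⟨{
    e := fun x => b (a x)
    s := fun i k l => mat K ζ₁ η₁ ⟨i, hS i⟩ (α i k) (β i l)
    t := fun i l k => matInv K ζ₁ η₁ ⟨i, hS i⟩ (β i l) (α i k)
    idem := fun x => by rw [← map_mul, idem]
    orth := fun x y h => by rw [← map_mul, orth x y h, map_zero]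
    sum_e := by rw [← map_sum, sum_a, map_one]
    corner_s := fun i k l => ?_
    corner_t := fun i l k => ?_
    s_mul_t := fun i k => ?_
    s_mul_t_ne := fun i k k' h => ?_
    t_mul_s := fun i l => ?_
    t_mul_s_ne := fun i l l' h => ?_ }, ?_, ?_⟩
  · have h := corner (K := K) (ζ := ζ₁) (η := η₁) ⟨i, hS i⟩ (α i k) (β i l)
    simp only [ζ₁, η₁] at h
    rw [← (β i).sum_comp] at h
    simp_rw [← (α i).sum_comp, hηm, hζm] at h
    simpa [apply_ite, ite_mul] using h
  · have h := cornerInv (K := K) (ζ := ζ₁) (η := η₁) ⟨i, hS i⟩ (β i l) (α i k)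
    simp only [ζ₁, η₁] at h
    rw [← (α i).sum_comp] at h
    simp_rw [← (β i).sum_comp, hηm, hζm] at h
    simpa [apply_ite, ite_mul] using h
  · have h := mat_mul_matInv (K := K) (ζ := ζ₁) (η := η₁) ⟨i, hS i⟩ (α i k) (α i k)
    rw [← (β i).sum_comp] at h
    exact h.trans (congrArg b (hζ i k))
  · have h := mat_mul_matInv (K := K) (ζ := ζ₁) (η := η₁) ⟨i, hS i⟩ (α i k) (α i k')
    rw [← (β i).sum_comp] at h
    exact h.trans ((congrArg b (hζ' i k k' ‹_›)).trans (map_zero b))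
  · have h := matInv_mul_mat (K := K) (ζ := ζ₁) (η := η₁) ⟨i, hS i⟩ (β i l) (β i l)
    rw [← (α i).sum_comp] at h
    exact h.trans (congrArg b (hη i l))
  · have h := matInv_mul_mat (K := K) (ζ := ζ₁) (η := η₁) ⟨i, hS i⟩ (β i l) (β i l')
    rw [← (α i).sum_comp] at h
    exact h.trans ((congrArg b (hη' i l l' ‹_›)).trans (map_zero b))
  · intro T he hs ht
    refine IsoExt.eq_top K T (fun y => ?_) (fun i k l => ?_) fun i l k => ?_
    · have : y ∈ T.comap b := gen (T.comap b) he ▸ Algebra.mem_top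
      exact this
    · have := hs i ((α i).symm k) ((β i).symm l)
      simpa only [Equiv.apply_symm_apply] using this
    · have := ht i ((β i).symm l) ((α i).symm k)
      simpa only [Equiv.apply_symm_apply] using this
  · intro C _ _ E
    obtain ⟨f, hf⟩ := lift C E.e E.idem E.orth E.sum_e
    refine Exists.elim (IsoExt.exists_lift K (ζ := ζ₁) (η := η₁) f
      (fun i k l => E.s i ((α i).symm k) ((β i).symm l))
      (fun i l k => E.t i ((β i).symm l) ((α i).symm k)) ?_ ?_ ?_ ?_) ?_
    rotate_left 4
    · rintro g ⟨hg, hs, ht⟩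
      refine ⟨g, fun x => (hg _).trans (hf x), fun i k l => ?_, fun i l k => ?_⟩
      · exact (hs _ _ _).trans (by simp)
      · exact (ht _ _ _).trans (by simp)
    · intro i k l
      obtain ⟨k, rfl⟩ := (α i).surjective k
      obtain ⟨l, rfl⟩ := (β i).surjective l
      simp only [ζ₁, η₁]
      rw [← (β i).sum_comp]
      simp_rw [← (α i).sum_comp, hηm, hζm]
      simpa [apply_ite, ite_mul, hf] using E.corner_s i k l
    · intro i l k
      obtain ⟨k, rfl⟩ := (α i).surjective k
      obtain ⟨l, rfl⟩ := (β i).surjective l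
      simp only [ζ₁, η₁]
      rw [← (α i).sum_comp]
      simp_rw [← (β i).sum_comp, hηm, hζm]
      simpa [apply_ite, ite_mul, hf] using E.corner_t i l k
    · intro i k k'
      obtain ⟨k, rfl⟩ := (α i).surjective k
      obtain ⟨k', rfl⟩ := (α i).surjective k'
      simp only [ζ₁, η₁]
      rw [← (β i).sum_comp, hζm]
      simp only [Equiv.symm_apply_apply]
      split_ifs with h
      · rw [hf, ← h, E.s_mul_t]
      · rw [map_zero, E.s_mul_t_ne _ _ _ h]
    · intro i k k'
      obtain ⟨k, rfl⟩ := (β i).surjective k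
      obtain ⟨k', rfl⟩ := (β i).surjective k'
      simp only [ζ₁, η₁]
      rw [← (α i).sum_comp, hηm]
      simp only [Equiv.symm_apply_apply]
      split_ifs with h
      · rw [hf, ← h, E.t_mul_s]
      · rw [map_zero, E.t_mul_s_ne _ _ _ h]

end UniversalSystem

/-! ### The Bergman algebra of a basic presentation -/

/-- If the matrices `ε x` are `1 × 1` matrices with entry `a x`, then `ε_c` is a diagonal matrix. -/
theorem SqMatrix.exists_equiv_ofSum {X : Type v} [Fintype X] [DecidableEq X] {A : Type u} [Ring A]
    (ε : X → SqMatrix.{u, v} A) (a : X → A) (h : ∀ x, ε x = ⟨PUnit, fun _ _ => a x⟩) (c : X →₀ ℕ) :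
    ∃ α : (Σ x, Fin (c x)) ≃ (ofSum ε c).ι,
      (∀ k, (ofSum ε c).mat (α k) (α k) = a k.1) ∧
        ∀ k k', k ≠ k' → (ofSum ε c).mat (α k) (α k') = 0 := by
  obtain rfl : ε = fun x => ⟨PUnit, fun _ _ => a x⟩ := funext h
  refine ⟨(Equiv.sigmaPUnit _).symm, fun k => ?_, fun k k' hk => ?_⟩
  · exact Matrix.blockDiagonal'_apply_eq
      (fun p : Σ x, Fin (c x) => (fun _ _ => a p.1 : Matrix PUnit.{v + 1} PUnit.{v + 1} A)) k ⟨⟩ ⟨⟩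
  · exact Matrix.blockDiagonal'_apply_ne
      (fun p : Σ x, Fin (c x) => (fun _ _ => a p.1 : Matrix PUnit.{v + 1} PUnit.{v + 1} A)) ⟨⟩ ⟨⟩ hk

namespace BergmanPresentation

variable (K : Type u) [Field K] {X : Type v} [Fintype X] [DecidableEq X] {I : Type w}

theorem IsBasic.blueStage_ordering {P : BergmanPresentation X I} (hP : P.IsBasic) :
    P.blueStage K P.ordering = P.initialStage K := by
  have h : P.ordering = [] := by
    refine List.eq_nil_iff_forall_not_mem.2 fun i hi => ?_
    have := (P.exists_admissible.choose_spec.2.1 i).1 hi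
    rw [hP.blue_eq_empty] at this
    exact this
  rw [h, blueStage, List.foldl_nil]

/-- The Bergman algebra of a basic presentation carries a universal system, for any indexing of
the summands of the two sides of the relations. -/
theorem IsBasic.exists_isUniversal {P : BergmanPresentation X I} (hP : P.IsBasic) {ι κ : I → Type v}
    [∀ i, Fintype (ι i)] [∀ i, Fintype (κ i)] (p : ∀ i, ι i → X) (q : ∀ i, κ i → X)
    (α : ∀ i, ι i ≃ Σ x, Fin (P.a i x)) (hα : ∀ i k, (α i k).1 = p i k)
    (β : ∀ i, κ i ≃ Σ x, Fin (P.b i x)) (hβ : ∀ i l, (β i l).1 = q i l) :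
    ∃ D : IsoSystem p q (P.algebra K), D.IsUniversal K := by
  suffices H : ∀ T : Stage K X, T = P.initialStage K →
      ∃ D : IsoSystem p q (P.redAlgebra K T), D.IsUniversal K from
    H _ (hP.blueStage_ordering K)
  rintro _ rfl
  have hx : ∀ x, x ∈ P.base := fun x => hP ▸ Set.mem_univ x
  classical
  let a : X → P.base → K := fun x => Pi.single ⟨x, hx x⟩ 1
  have hε : ∀ x, (P.initialStage K).ε x = ⟨PUnit, fun _ _ => a x⟩ := by
    intro x
    simp only [initialStage, dif_pos (hx x), a]
  have sum_a : ∀ f : P.base → K, f = ∑ x, f ⟨x, hx x⟩ • a x := by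
    intro f
    ext ⟨y, hy⟩
    simp [a, Finset.sum_apply, Pi.single_apply]
  choose γ hγ hγ' using fun i => SqMatrix.exists_equiv_ofSum _ a hε (P.a i)
  choose δ hδ hδ' using fun i => SqMatrix.exists_equiv_ofSum _ a hε (P.b i)
  refine IsoExt.exists_isUniversal (K := K) (A := P.base → K) a ?_ ?_ ?_ ?_ ?_ P.blue ?_
    (fun i => SqMatrix.ofSum (P.initialStage K).ε (P.a i))
    (fun i => SqMatrix.ofSum (P.initialStage K).ε (P.b i)) p q
    (fun i => (α i).trans (γ i)) (fun i => (β i).trans (δ i))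
    (fun i k => ?_) (fun i k k' h => hγ' i _ _ ((α i).injective.ne h))
    (fun i k => ?_) (fun i k k' h => hδ' i _ _ ((β i).injective.ne h))
  · intro x
    simp [a, ← Pi.single_mul]
  · intro x y hxy
    ext z
    by_cases h : z = ⟨x, hx x⟩
    · subst h
      simp [a, hxy]
    · simp [a, h]
  · rw [sum_a 1]
    simp
  · intro S hS
    refine eq_top_iff.2 fun f _ => ?_
    rw [sum_a f]
    exact S.sum_mem fun x _ => S.smul_mem (hS x) _
  · intro C _ _ c h1 h2 h3
    refine ⟨AlgHom.ofLinearMap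
      (∑ x, (LinearMap.proj (⟨x, hx x⟩ : P.base)).smulRight (c x)) ?_ ?_, fun x => ?_⟩
    · simpa using h3
    · intro f g
      simp only [LinearMap.sum_apply, LinearMap.smulRight_apply, LinearMap.proj_apply,
        Pi.mul_apply, Finset.sum_mul_sum]
      refine Finset.sum_congr rfl fun x _ => ?_
      rw [Finset.sum_eq_single x]
      · rw [smul_mul_smul_comm, h1]
      · intro y _ hy
        simp [h2 x y hy.symm]
      · simp
    · simp [a, Pi.single_apply]
  · simp [hP.blue_eq_empty]
  · exact (hγ i _).trans (congrArg a (hα i k))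
  · exact (hδ i _).trans (congrArg a (hβ i k))

end BergmanPresentation

/-! ### Representations -/

section Rep

/-- A representation consists of a `K`-module `V x` for every `x : X` and of isomorphisms between
the direct sums of the modules `V (p j k)` and `V (q j l)`. -/
structure Rep (K : Type u) [Field K] {X : Type v} {J : Type w} {ι κ : J → Type v}
    (p : ∀ j, ι j → X) (q : ∀ j, κ j → X) where
  V : X → Type t
  [addCommGroup : ∀ x, AddCommGroup (V x)]
  [module : ∀ x, Module K (V x)]
  iso : ∀ j, (∀ k, V (p j k)) ≃ₗ[K] ∀ l, V (q j l)

namespace Rep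

attribute [instance] Rep.addCommGroup Rep.module

variable {K : Type u} [Field K] {X : Type v} {J : Type w} {ι κ : J → Type v}
  {p : ∀ j, ι j → X} {q : ∀ j, κ j → X}

/-- The morphisms of representations. -/
def homs (R S : Rep.{u, v, w, t} K p q) : Submodule K (∀ x, R.V x →ₗ[K] S.V x) where
  carrier := {f | ∀ j v l, S.iso j (fun k => f _ (v k)) l = f _ (R.iso j v l)}
  add_mem' {f g} hf hg j v l := by
    have h := map_add (S.iso j) (fun k => f _ (v k)) (fun k => g _ (v k))
    exact (congrFun h l).trans (congrArg₂ (· + ·) (hf j v l) (hg j v l))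
  zero_mem' j v l := congrFun (map_zero (S.iso j)) l
  smul_mem' c f hf j v l := by
    have h := map_smul (S.iso j) c (fun k => f _ (v k))
    exact (congrFun h l).trans (congrArg (c • ·) (hf j v l))

instance : Category (Rep.{u, v, w, t} K p q) where
  Hom R S := R.homs S
  id R := ⟨fun _ => LinearMap.id, fun _ _ _ => rfl⟩
  comp {R S T} f g := ⟨fun x => g.1 x ∘ₗ f.1 x, fun j v l =>
    (g.2 j (fun k => f.1 _ (v k)) l).trans (congrArg (g.1 _) (f.2 j v l))⟩

instance (R S : Rep.{u, v, w, t} K p q) : AddCommGroup (R ⟶ S) :=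
  inferInstanceAs (AddCommGroup (R.homs S))

instance (R S : Rep.{u, v, w, t} K p q) : Module K (R ⟶ S) :=
  inferInstanceAs (Module K (R.homs S))

@[ext]
theorem hom_ext {R S : Rep.{u, v, w, t} K p q} {f g : R ⟶ S} (h : ∀ x n, f.1 x n = g.1 x n) :
    f = g :=
  Subtype.ext (funext fun x => LinearMap.ext (h x))

instance : Preadditive (Rep.{u, v, w, t} K p q) where
  add_comp _ _ _ f g h := hom_ext fun x n => map_add (h.1 x) (f.1 x n) (g.1 x n)
  comp_add _ _ _ _ _ _ := rfl

instance : Linear K (Rep.{u, v, w, t} K p q) where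
  smul_comp _ _ _ c f h := hom_ext fun x n => map_smul (h.1 x) c (f.1 x n)
  comp_smul _ _ _ _ _ _ := rfl

theorem isIso_of_bijective {R S : Rep.{u, v, w, t} K p q} (f : R ⟶ S)
    (hf : ∀ x, Function.Bijective (f.1 x)) : IsIso f := by
  let e : ∀ x, R.V x ≃ₗ[K] S.V x := fun x => LinearEquiv.ofBijective (f.1 x) (hf x)
  have he : ∀ x n, e x n = f.1 x n := fun _ _ => rfl
  refine ⟨⟨fun x => (e x).symm, fun j v l => ?_⟩, ?_, ?_⟩
  · obtain ⟨w, rfl⟩ : ∃ w : ∀ k, R.V (p j k), v = fun k => f.1 _ (w k) :=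
      ⟨fun k => (e _).symm (v k), funext fun k => ((e _).apply_symm_apply (v k)).symm⟩
    rw [f.2 j w l, ← he]
    simp only [← he, LinearEquiv.coe_coe, LinearEquiv.symm_apply_apply]
  · exact hom_ext fun x n => (e x).symm_apply_apply n
  · exact hom_ext fun x n => (e x).apply_symm_apply n

end Rep

end Rep

/-! ### Modules over an algebra with a universal system as representations -/

namespace IsoSystem

variable {X : Type v} {J : Type w} {ι κ : J → Type v} [∀ j, Fintype (ι j)] [∀ j, Fintype (κ j)]
  [Fintype X] {p : ∀ j, ι j → X} {q : ∀ j, κ j → X}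

section Ring

variable {B : Type*} [Ring B] (D : IsoSystem p q B)

theorem e_mul_s (j k l) : D.e (p j k) * D.s j k l = D.s j k l := by
  rw [← D.corner_s, ← mul_assoc, ← mul_assoc, D.idem]

theorem s_mul_e (j k l) : D.s j k l * D.e (q j l) = D.s j k l := by
  rw [← D.corner_s, mul_assoc, D.idem]

theorem e_mul_t (j l k) : D.e (q j l) * D.t j l k = D.t j l k := by
  rw [← D.corner_t, ← mul_assoc, ← mul_assoc, D.idem]

theorem t_mul_e (j l k) : D.t j l k * D.e (p j k) = D.t j l k := by
  rw [← D.corner_t, mul_assoc, D.idem]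

theorem sum_smul {M : Type*} [AddCommGroup M] [Module B M] (m : M) : ∑ x, D.e x • m = m := by
  rw [← Finset.sum_smul, D.sum_e, one_smul]

end Ring

variable (K : Type u) [Field K] {B : Type*} [Ring B] [Algebra K B] (D : IsoSystem p q B)

section Part

variable (M : Type*) [AddCommGroup M] [Module B M] [Module K M] [IsScalarTower K B M]

/-- The summand `e x • M` of the `B`-module `M`. -/
def part (x : X) : Submodule K M where
  carrier := {m | D.e x • m = m}
  add_mem' {m n} hm hn := by
    rw [Set.mem_ofPred_eq] at *
    rw [smul_add, hm, hn]
  zero_mem' := smul_zero _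
  smul_mem' c m hm := by
    rw [Set.mem_ofPred_eq] at *
    rw [smul_comm, hm]

variable {M}

theorem mem_part {x : X} {m : M} : m ∈ D.part K M x ↔ D.e x • m = m := Iff.rfl

theorem smul_coe (x : X) (m : D.part K M x) : D.e x • (m : M) = m := m.2

theorem e_smul_mem (x : X) (m : M) : D.e x • m ∈ D.part K M x := by
  rw [mem_part, ← mul_smul, D.idem]

theorem s_smul_mem (j k l) (m : M) : D.s j k l • m ∈ D.part K M (p j k) := by
  rw [mem_part, ← mul_smul, D.e_mul_s]

theorem t_smul_mem (j l k) (m : M) : D.t j l k • m ∈ D.part K M (q j l) := by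
  rw [mem_part, ← mul_smul, D.e_mul_t]

variable (M)

/-- The projection from `M` to its summand `e x • M`. -/
def toPart (x : X) : M →ₗ[K] D.part K M x where
  toFun m := ⟨D.e x • m, D.e_smul_mem K x m⟩
  map_add' m n := Subtype.ext (smul_add _ m n)
  map_smul' c m := Subtype.ext (smul_comm _ c m)

theorem coe_toPart (x : X) (m : M) : (D.toPart K M x m : M) = D.e x • m := rfl

theorem toPart_coe (x : X) (m : D.part K M x) : D.toPart K M x (m : M) = m := Subtype.ext m.2

theorem toPart_coe_ne {x y : X} (h : y ≠ x) (m : D.part K M x) : D.toPart K M y (m : M) = 0 := by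
  refine Subtype.ext ?_
  rw [coe_toPart, ← D.smul_coe K, ← mul_smul, D.orth _ _ h, zero_smul, Submodule.coe_zero]

/-- The isomorphism given by the matrices of the system. -/
def partIso (j : J) : (∀ k, D.part K M (p j k)) ≃ₗ[K] ∀ l, D.part K M (q j l) where
  toFun v l := ⟨∑ k, D.t j l k • (v k : M), Submodule.sum_mem _ fun k _ => D.t_smul_mem K j l k _⟩
  map_add' v v' := by
    ext l
    simp [smul_add, Finset.sum_add_distrib]
  map_smul' c v := by
    ext l
    simp only [Pi.smul_apply, Submodule.coe_smul, RingHom.id_apply, Finset.smul_sum]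
    refine Finset.sum_congr rfl fun k _ => ?_
    rw [smul_comm]
  invFun v k := ⟨∑ l, D.s j k l • (v l : M), Submodule.sum_mem _ fun l _ => D.s_smul_mem K j k l _⟩
  left_inv v := by
    ext k
    simp only [Finset.smul_sum, ← mul_smul]
    rw [Finset.sum_comm]
    simp only [← Finset.sum_smul]
    rw [Finset.sum_eq_single k, D.s_mul_t, D.smul_coe K]
    · intro k' _ hk
      rw [D.s_mul_t_ne _ _ _ hk.symm, zero_smul]
    · simp
  right_inv v := by
    ext k
    simp only [Finset.smul_sum, ← mul_smul]
    rw [Finset.sum_comm]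
    simp only [← Finset.sum_smul]
    rw [Finset.sum_eq_single k, D.t_mul_s, D.smul_coe K]
    · intro k' _ hk
      rw [D.t_mul_s_ne _ _ _ hk.symm, zero_smul]
    · simp

theorem coe_partIso (j : J) (v : ∀ k, D.part K M (p j k)) (l : κ j) :
    (D.partIso K M j v l : M) = ∑ k, D.t j l k • (v k : M) := rfl

theorem coe_partIso_symm (j : J) (v : ∀ l, D.part K M (q j l)) (k : ι j) :
    ((D.partIso K M j).symm v k : M) = ∑ l, D.s j k l • (v l : M) := rfl

end Part

open scoped ModuleCat.Algebra

/-- The functor which maps a `B`-module `M` to the representation with the modules `e x • M`. -/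
def toRep : ModuleCat.{t} B ⥤ Rep.{u, v, w, t} K p q where
  obj M :=
    { V := fun x => D.part K M x
      iso := fun j => D.partIso K M j }
  map {M N} f := ⟨fun x =>
    { toFun := fun m => ⟨f.hom m, by rw [mem_part, ← map_smul, D.smul_coe K]⟩
      map_add' := fun m n => Subtype.ext (map_add f.hom (m : M) n)
      map_smul' := fun c m => Subtype.ext (map_smul f.hom (algebraMap K B c) (m : M)) },
    fun j v l => Subtype.ext <| by
      change ∑ k, D.t j l k • f.hom (v k : M) = f.hom (∑ k, D.t j l k • (v k : M))
      simp⟩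

instance : (D.toRep K).Additive where

instance : (D.toRep K).Linear K where

instance : (D.toRep K).Faithful where
  map_injective {M N} f g h := by
    ext m
    rw [← D.sum_smul m, map_sum, map_sum]
    refine Finset.sum_congr rfl fun x _ => ?_
    have := congrArg (fun φ => ((φ.1 x ⟨_, D.e_smul_mem K x m⟩ : D.part K N x) : N)) h
    exact this

variable {K} {D}

theorem IsUniversal.full (hD : D.IsUniversal K) : (D.toRep.{u, v, w, t} K).Full where
  map_surjective {M N} g := by
    classical
    let γ : ∀ x, D.part K M x →ₗ[K] D.part K N x := g.1
    let f : M →ₗ[K] N :=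
      ∑ x, (D.part K N x).subtype ∘ₗ γ x ∘ₗ D.toPart K M x
    have hf : ∀ m, f m = ∑ x, (γ x (D.toPart K M x m) : N) := fun m => by
      simp [f]
    have hfx : ∀ x (m : D.part K M x), f m = γ x m := by
      intro x m
      rw [hf, Finset.sum_eq_single x]
      · rw [D.toPart_coe K]
      · intro y _ hy
        rw [D.toPart_coe_ne K M hy, map_zero, Submodule.coe_zero]
      · simp
    have hγ : ∀ x m, (γ x (D.toPart K M x m) : N) = D.e x • f m := by
      intro x m
      rw [hf, Finset.smul_sum, Finset.sum_eq_single x, D.smul_coe K]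
      · intro y _ hy
        rw [← D.smul_coe K, ← mul_smul, D.orth _ _ hy.symm, zero_smul]
      · simp
    have hg : ∀ j v l, D.partIso K N j (fun k => γ _ (v k)) l = γ _ (D.partIso K M j v l) := g.2
    have hg' : ∀ j v k,
        (D.partIso K N j).symm (fun l => γ _ (v l)) k = γ _ ((D.partIso K M j).symm v k) := by
      intro j v k
      obtain ⟨w, rfl⟩ := (D.partIso K M j).surjective v
      rw [← funext (hg j w), LinearEquiv.symm_apply_apply, LinearEquiv.symm_apply_apply]
    let T : Subalgebra K B :=
      { carrier := {b | ∀ m, f (b • m) = b • f m}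
        mul_mem' := fun {b c} hb hc m => by rw [mul_smul, hb, hc, mul_smul]
        add_mem' := fun {b c} hb hc m => by rw [add_smul, map_add, hb, hc, add_smul]
        algebraMap_mem' := fun c m => map_smul f c m }
    have hT : T = ⊤ := by
      refine hD.eq_top T (fun x m => ?_) (fun j k l m => ?_) fun j l k m => ?_
      · rw [← hγ, ← hfx, D.coe_toPart K]
      · have h := congrArg Subtype.val (hg' j (Pi.single l (D.toPart K M _ m)) k)
        rw [← hfx, coe_partIso_symm, coe_partIso_symm, Finset.sum_eq_single l,
          Finset.sum_eq_single l] at h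
        · simp only [Pi.single_eq_same] at h
          rw [hγ, D.coe_toPart K, ← mul_smul, ← mul_smul, D.s_mul_e] at h
          exact h.symm
        · intro l' _ hl
          simp [hl]
        · simp
        · intro l' _ hl
          simp [hl]
        · simp
      · have h := congrArg Subtype.val (hg j (Pi.single k (D.toPart K M _ m)) l)
        rw [← hfx, coe_partIso, coe_partIso, Finset.sum_eq_single k,
          Finset.sum_eq_single k] at h
        · simp only [Pi.single_eq_same] at h
          rw [hγ, D.coe_toPart K, ← mul_smul, ← mul_smul, D.t_mul_e] at h
          exact h.symm
        · intro l' _ hl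
          simp [hl]
        · simp
        · intro l' _ hl
          simp [hl]
        · simp
    refine ⟨ModuleCat.ofHom { f with map_smul' := fun b m => ?_ }, ?_⟩
    · have : b ∈ T := hT ▸ Algebra.mem_top
      exact this m
    · exact Rep.hom_ext fun x m => Subtype.ext (hfx x m)

end IsoSystem

/-! ### The module which corresponds to a representation -/

section Block

variable {K : Type u} [Field K] {X : Type v} [DecidableEq X] {V : X → Type t}
  [∀ x, AddCommGroup (V x)] [∀ x, Module K (V x)]

variable (K V) in
/-- The projection of the product onto its factor with index `x`. -/
def projEnd (x : X) : Module.End K (∀ x, V x) :=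
  LinearMap.single K V x ∘ₗ LinearMap.proj x

theorem projEnd_apply (x : X) (v : ∀ x, V x) : projEnd K V x v = Pi.single x (v x) := rfl

variable {ι κ μ : Type*} [DecidableEq ι] {p : ι → X} {q : κ → X} {r : μ → X}

/-- A matrix entry of a linear map between products, as an endomorphism. -/
def block (f : (∀ k, V (p k)) →ₗ[K] ∀ l, V (q l)) (l : κ) (k : ι) : Module.End K (∀ x, V x) :=
  LinearMap.single K V (q l) ∘ₗ LinearMap.proj l ∘ₗ f ∘ₗ
    LinearMap.single K (fun k => V (p k)) k ∘ₗ LinearMap.proj (p k)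

theorem block_apply (f : (∀ k, V (p k)) →ₗ[K] ∀ l, V (q l)) (l : κ) (k : ι) (v : ∀ x, V x) :
    block f l k v = Pi.single (q l) (f (Pi.single k (v (p k))) l) := rfl

theorem sum_block_mul_block [Fintype κ] [DecidableEq κ] (f : (∀ k, V (p k)) →ₗ[K] ∀ l, V (q l))
    (g : (∀ l, V (q l)) →ₗ[K] ∀ m, V (r m)) (m : μ) (k : ι) :
    ∑ l, block g m l * block f l k = block (g ∘ₗ f) m k := by
  refine LinearMap.ext fun v => ?_
  simp only [LinearMap.sum_apply, Module.End.mul_apply, block_apply, Pi.single_eq_same]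
  have h : ∀ w : ∀ l, V (q l), ∑ l, g (Pi.single l (w l)) m = g w m := by
    intro w
    rw [← Finset.sum_apply, ← map_sum, Finset.univ_sum_single]
  rw [LinearMap.comp_apply, ← h]
  exact (map_sum (LinearMap.single K V (r m)) _ _).symm

theorem block_id (k : ι) : block (LinearMap.id : (∀ k, V (p k)) →ₗ[K] _) k k = projEnd K V (p k) := by
  refine LinearMap.ext fun v => ?_
  simp [block_apply, projEnd_apply]

theorem block_id_ne {k k' : ι} (h : k ≠ k') :
    block (LinearMap.id : (∀ k, V (p k)) →ₗ[K] _) k k' = 0 := by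
  refine LinearMap.ext fun v => ?_
  simp [block_apply, h]

theorem projEnd_mul_block_mul (f : (∀ k, V (p k)) →ₗ[K] ∀ l, V (q l)) (l : κ) (k : ι) :
    projEnd K V (q l) * block f l k * projEnd K V (p k) = block f l k := by
  refine LinearMap.ext fun v => ?_
  simp [block_apply, projEnd_apply]

end Block

namespace Rep

variable {K : Type u} [Field K] {X : Type v} {J : Type w} {ι κ : J → Type v}
  [∀ j, Fintype (ι j)] [∀ j, Fintype (κ j)] [Fintype X]
  {p : ∀ j, ι j → X} {q : ∀ j, κ j → X}

open Classical in
/-- The system of endomorphisms of the product of the modules of a representation. -/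
def endSystem (R : Rep.{u, v, w, t} K p q) : IsoSystem p q (Module.End K (∀ x, R.V x)) where
  e x := projEnd K R.V x
  s j k l := block (R.iso j).symm.toLinearMap k l
  t j l k := block (R.iso j).toLinearMap l k
  idem x := LinearMap.ext fun v => by simp [projEnd_apply]
  orth x y h := LinearMap.ext fun v => by simp [projEnd_apply, h]
  sum_e := LinearMap.ext fun v => by simp [projEnd_apply, Finset.univ_sum_single]
  corner_s j k l := projEnd_mul_block_mul _ _ _
  corner_t j l k := projEnd_mul_block_mul _ _ _
  s_mul_t j k := by
    rw [sum_block_mul_block, LinearEquiv.symm_comp, block_id]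
  s_mul_t_ne j k k' h := by
    rw [sum_block_mul_block, LinearEquiv.symm_comp, block_id_ne h]
  t_mul_s j l := by
    rw [sum_block_mul_block, LinearEquiv.comp_symm, block_id]
  t_mul_s_ne j l l' h := by
    rw [sum_block_mul_block, LinearEquiv.comp_symm, block_id_ne h]

/-- The product of the modules of a representation as a module over an algebra which acts on it. -/
def toModule {B : Type*} [Ring B] [Algebra K B] (R : Rep.{u, v, w, t} K p q)
    (f : B →ₐ[K] Module.End K (∀ x, R.V x)) : ModuleCat.{max v t} B :=
  letI : Module B (∀ x, R.V x) := Module.compHom _ f.toRingHom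
  ModuleCat.of B (∀ x, R.V x)

end Rep

namespace IsoSystem

variable {K : Type u} [Field K] {X : Type v} {J : Type w} {ι κ : J → Type v}
  [∀ j, Fintype (ι j)] [∀ j, Fintype (κ j)] [Fintype X]
  {p : ∀ j, ι j → X} {q : ∀ j, κ j → X} {B : Type*} [Ring B] [Algebra K B] {D : IsoSystem p q B}

open scoped ModuleCat.Algebra

theorem IsUniversal.essSurj (hD : D.IsUniversal K) :
    (D.toRep.{u, v, w, max u v w} K).EssSurj where
  mem_essImage R := by
    classical
    obtain ⟨f, hfe, hfs, hft⟩ := hD.exists_lift _ R.endSystem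
    let M : ModuleCat.{max u v w} B := R.toModule f
    let ψ : (∀ x, R.V x) ≃+ M := AddEquiv.refl _
    have hsmul : ∀ (b : B) (v : ∀ x, R.V x), b • ψ v = ψ (f b v) := fun _ _ => rfl
    have he : ∀ x v, D.e x • ψ v = ψ (Pi.single x (v x)) := fun x v => by
      rw [hsmul, hfe]
      rfl
    let θ : ∀ x, R.V x →ₗ[K] D.part K M x := fun x =>
      { toFun := fun n => ⟨ψ (Pi.single x n), by
          rw [mem_part, he, Pi.single_eq_same]⟩
        map_add' := fun m n => Subtype.ext ((congrArg ψ (Pi.single_add x m n)).trans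
          (map_add ψ _ _))
        map_smul' := fun c m => Subtype.ext <| by
          refine (congrArg ψ (Pi.single_smul x c m)).trans ?_
          change _ = algebraMap K B c • ψ _
          rw [hsmul, f.commutes]
          rfl }
    have hθ : ∀ x n, (θ x n : M) = ψ (Pi.single x n) := fun _ _ => rfl
    have hθb : ∀ x, Function.Bijective (θ x) := by
      refine fun x => ⟨fun m n h => ?_, fun m => ?_⟩
      · exact Pi.single_injective x (ψ.injective (congrArg Subtype.val h))
      · refine ⟨ψ.symm (m : M) x, Subtype.ext ?_⟩
        rw [hθ, ← he, AddEquiv.apply_symm_apply, D.smul_coe K]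
    let φ : R ⟶ (D.toRep K).obj M := ⟨θ, fun j v l => Subtype.ext <| by
      change ∑ k, D.t j l k • (θ _ (v k) : M) = θ _ (R.iso j v l)
      simp only [hθ]
      have h : ∀ k, D.t j l k • ψ (Pi.single (p j k) (v k)) =
          ψ (LinearMap.single K R.V (q j l) (R.iso j (Pi.single k (v k)) l)) := by
        intro k
        rw [hsmul, hft]
        exact congrArg ψ ((block_apply _ _ _ _).trans (by rw [Pi.single_eq_same]; rfl))
      refine (Finset.sum_congr rfl fun k _ => h k).trans ?_
      rw [← map_sum, ← map_sum, ← Finset.sum_apply, ← map_sum, Finset.univ_sum_single]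
      rfl⟩
    have := Rep.isIso_of_bijective φ hθb
    exact ⟨M, ⟨(asIso φ).symm⟩⟩

theorem IsUniversal.isEquivalence (hD : D.IsUniversal K) :
    (D.toRep.{u, v, w, max u v w} K).IsEquivalence where
  full := hD.full
  essSurj := hD.essSurj

end IsoSystem

/-! ### Collapsing a representation -/

/-- Labels for the summands of what a generator `z` is replaced by, when `x` is replaced by a sum
with summands labelled by `β`. -/
inductive Fiber {X : Type v} (x : X) (β : Type v) : X → Type v
  | self (z : X) (h : z ≠ x) : Fiber x β z
  | sub (l : β) : Fiber x β x

/-- The summand with a given label, where `r l` is the summand with label `l` of the sum by which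
`x` is replaced. -/
def Fiber.target {X : Type v} {x : X} {β : Type v} (r : β → {y // y ≠ x}) :
    ∀ {z : X}, Fiber x β z → {y // y ≠ x}
  | _, .self z h => ⟨z, h⟩
  | _, .sub l => r l

/-- The word obtained from the word `f` by the replacement. -/
def Fiber.word {X : Type v} {x : X} {β : Type v} (r : β → {y // y ≠ x}) {α : Type v} (f : α → X)
    (m : Σ k, Fiber x β (f k)) : {y // y ≠ x} :=
  Fiber.target r m.2

theorem Fiber.exists_eq_sub {X : Type v} {x : X} {β : Type v} (m : Fiber x β x) :
    ∃ l, m = .sub l := by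
  cases m with
  | self z h => exact absurd rfl h
  | sub l => exact ⟨l, rfl⟩

theorem Fiber.eq_self {X : Type v} {x : X} {β : Type v} {z : X} (h : z ≠ x) (m : Fiber x β z) :
    m = .self z h := by
  cases m with
  | self z h => rfl
  | sub l => exact absurd rfl h

namespace Rep

variable {K : Type u} [Field K] {X : Type v} {I : Type w} {ι κ : I → Type v}
  {p : ∀ j, ι j → X} {q : ∀ j, κ j → X} {i : I} [Unique (ι i)]
  (hq : ∀ l, q i l ≠ p i default)

/-- The left hand sides of the relations of the collapsed presentation. -/
abbrev collapseLeft (j : {j // j ≠ i}) (m : Σ k, Fiber (p i default) (κ i) (p j k)) :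
    {y // y ≠ p i default} :=
  Fiber.word (fun l => ⟨q i l, hq l⟩) (p j) m

/-- The right hand sides of the relations of the collapsed presentation. -/
abbrev collapseRight (j : {j // j ≠ i}) (m : Σ k, Fiber (p i default) (κ i) (q j k)) :
    {y // y ≠ p i default} :=
  Fiber.word (fun l => ⟨q i l, hq l⟩) (q j) m

section Expand

variable (R : Rep.{u, v, w, t} K p q)

/-- The components of the isomorphism `Rep.expand`. -/
def expandAux : ∀ {z : X} (m : Fiber (p i default) (κ i) z),
    R.V z →ₗ[K] R.V (m.target fun l => ⟨q i l, hq l⟩).1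
  | _, .self _ _ => LinearMap.id
  | _, .sub l => LinearMap.proj l ∘ₗ (R.iso i).toLinearMap ∘ₗ
      (LinearEquiv.piUnique K fun k => R.V (p i k)).symm.toLinearMap

theorem expandAux_sub (l : κ i) (v : ∀ k, R.V (p i k)) :
    R.expandAux hq (.sub l) (v default) = R.iso i v l :=
  congrArg (fun v => R.iso i v l) ((LinearEquiv.piUnique K fun k => R.V (p i k)).symm_apply_apply v)

theorem expandAux_bijective (z : X) :
    Function.Bijective (LinearMap.pi fun m => R.expandAux hq (z := z) m) := by
  by_cases h : z = p i default
  · subst h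
    refine ⟨fun n n' hn => ?_, fun u => ?_⟩
    · obtain ⟨v, rfl⟩ := (LinearEquiv.piUnique K fun k => R.V (p i k)).surjective n
      obtain ⟨v', rfl⟩ := (LinearEquiv.piUnique K fun k => R.V (p i k)).surjective n'
      have : v = v' := (R.iso i).injective <| funext fun l => by
        rw [← expandAux_sub hq, ← expandAux_sub hq]
        exact congrFun hn (.sub l)
      rw [this]
    · obtain ⟨v, hv⟩ := (R.iso i).surjective fun l => u (.sub l)
      refine ⟨v default, funext fun m => ?_⟩
      obtain ⟨l, rfl⟩ := m.exists_eq_sub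
      exact (expandAux_sub hq R l v).trans (congrFun hv l)
  · refine ⟨fun n n' hn => congrFun hn (.self z h), fun u => ⟨u (.self z h), funext fun m => ?_⟩⟩
    obtain rfl := m.eq_self h
    rfl

/-- The isomorphism between `V z` and the direct sum of modules by which it is replaced. -/
def expand (z : X) : R.V z ≃ₗ[K] ∀ m : Fiber (p i default) (κ i) z,
    R.V (m.target fun l => ⟨q i l, hq l⟩).1 :=
  LinearEquiv.ofBijective _ (R.expandAux_bijective hq z)

theorem expand_apply {z : X} (n : R.V z) (m : Fiber (p i default) (κ i) z) :
    R.expand hq z n m = R.expandAux hq m n := rfl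

/-- The isomorphism between the direct sum given by a word and the direct sum given by the word
which results from the replacement. -/
def expandWord {α : Type v} (f : α → X) :
    (∀ k, R.V (f k)) ≃ₗ[K]
      ∀ m : Σ k, Fiber (p i default) (κ i) (f k), R.V (Fiber.word (fun l => ⟨q i l, hq l⟩) f m).1 where
  toFun v m := R.expandAux hq m.2 (v m.1)
  map_add' _ _ := funext fun m => map_add (R.expandAux hq m.2) _ _
  map_smul' c _ := funext fun m => map_smul (R.expandAux hq m.2) c _
  invFun u k := (R.expand hq (f k)).symm fun m => u ⟨k, m⟩
  left_inv v := funext fun k => (R.expand hq (f k)).symm_apply_apply (v k)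
  right_inv _ := funext fun m => congrFun ((R.expand hq (f m.1)).apply_symm_apply _) m.2

theorem expandWord_apply {α : Type v} (f : α → X) (v : ∀ k, R.V (f k))
    (m : Σ k, Fiber (p i default) (κ i) (f k)) :
    R.expandWord hq f v m = R.expandAux hq m.2 (v m.1) := rfl

theorem hom_expandAux {R S : Rep.{u, v, w, t} K p q} (f : R ⟶ S) {z : X} (n : R.V z)
    (m : Fiber (p i default) (κ i) z) :
    S.expandAux hq m (f.1 z n) = f.1 _ (R.expandAux hq m n) := by
  cases m with
  | self z h => rfl
  | sub l =>
    obtain ⟨v, rfl⟩ := (LinearEquiv.piUnique K fun k => R.V (p i k)).surjective n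
    have := expandAux_sub hq S l (fun k => f.1 _ (v k))
    refine this.trans ((f.2 i v l).trans ?_)
    exact congrArg (f.1 _) (expandAux_sub hq R l v).symm

end Expand

variable (K) in
/-- Collapsing representations: the `i`-th relation expresses the module with index `p i default`
through the other ones. -/
def collapse : Rep.{u, v, w, t} K p q ⥤ Rep.{u, v, w, t} K (collapseLeft hq) (collapseRight hq) where
  obj R :=
    { V := fun y => R.V y.1
      iso := fun j => (R.expandWord hq (p j)).symm ≪≫ₗ R.iso j ≪≫ₗ R.expandWord hq (q j) }
  map {R S} f := ⟨fun y => f.1 y.1, fun j u m => by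
    obtain ⟨v, rfl⟩ := (R.expandWord hq (p j)).surjective u
    have h : (fun k => f.1 _ (R.expandWord hq (p j) v k)) =
        S.expandWord hq (p j) fun k => f.1 _ (v k) :=
      funext fun m => (hom_expandAux hq f _ m.2).symm
    simp only [LinearEquiv.trans_apply, LinearEquiv.symm_apply_apply]
    refine (congrFun (congrArg (fun u => S.expandWord hq (q j) (S.iso j
      ((S.expandWord hq (p j)).symm u))) h) m).trans ?_
    rw [LinearEquiv.symm_apply_apply, expandWord_apply, f.2 j v, hom_expandAux hq]
    rfl⟩

theorem collapse_iso (R : Rep.{u, v, w, t} K p q) (j : {j // j ≠ i}) (v : ∀ k, R.V (p j k)) :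
    ((collapse K hq).obj R).iso j (R.expandWord hq (p j) v) = R.expandWord hq (q j) (R.iso j v) :=
  congrArg (fun v => R.expandWord hq (q j) (R.iso j v))
    ((R.expandWord hq (p j)).symm_apply_apply v)

instance : (collapse.{u, v, w, t} K hq).Additive where

instance : (collapse.{u, v, w, t} K hq).Linear K where

instance : (collapse.{u, v, w, t} K hq).Faithful where
  map_injective {R S} f g h := by
    refine hom_ext fun z n => (S.expand hq z).injective (funext fun m => ?_)
    rw [expand_apply, expand_apply, hom_expandAux, hom_expandAux]
    exact LinearMap.congr_fun (congrFun (congrArg Subtype.val h)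
      (m.target fun l => ⟨q i l, hq l⟩)) _

instance : (collapse.{u, v, w, t} K hq).Full where
  map_surjective {R S} g := by
    let γ : ∀ y : {y // y ≠ p i default}, R.V y.1 →ₗ[K] S.V y.1 := g.1
    let f : ∀ z, R.V z →ₗ[K] S.V z := fun z => (S.expand hq z).symm.toLinearMap ∘ₗ
      LinearMap.pi fun m => γ (m.target fun l => ⟨q i l, hq l⟩) ∘ₗ R.expandAux hq m
    have hf : ∀ {z} (n : R.V z) (m : Fiber (p i default) (κ i) z),
        S.expandAux hq m (f z n) = γ _ (R.expandAux hq m n) := fun n m =>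
      congrFun ((S.expand hq _).apply_symm_apply _) m
    have hfγ : ∀ (y : {y // y ≠ p i default}) n, f y.1 n = γ y n := fun y n =>
      hf n (.self y.1 y.2)
    refine ⟨⟨f, fun j v l => ?_⟩, hom_ext hfγ⟩
    by_cases hj : j = i
    · subst hj
      rw [← expandAux_sub hq S l (fun k => f _ (v k)), hf, expandAux_sub]
      exact (hfγ ⟨_, hq l⟩ _).symm
    · suffices H : S.iso j (fun k => f _ (v k)) = fun l => f _ (R.iso j v l) from congrFun H l
      refine (S.expandWord hq (q j)).injective ?_
      have h := g.2 ⟨j, hj⟩ (R.expandWord hq (p j) v)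
      rw [collapse_iso hq R ⟨j, hj⟩] at h
      have h' : (fun k => γ _ (R.expandWord hq (p j) v k)) =
        S.expandWord hq (p j) fun k => f _ (v k) := funext fun m => (hf _ _).symm
      have h2 := collapse_iso hq S ⟨j, hj⟩ fun k => f _ (v k)
      refine h2.symm.trans (funext fun m => ?_)
      refine (congrFun (congrArg (((collapse K hq).obj S).iso ⟨j, hj⟩) h'.symm) m).trans ?_
      exact (h m).trans (hf _ _).symm

section Extend

variable (K) in
/-- The components of the isomorphism `Rep.selfEquiv`. -/
def selfAux {x : X} {β : Type v} (r : β → {y // y ≠ x}) (V : {y // y ≠ x} → Type t)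
    [∀ y, AddCommGroup (V y)] [∀ y, Module K (V y)] :
    ∀ {z : X} (h : z ≠ x) (m : Fiber x β z), V ⟨z, h⟩ →ₗ[K] V (m.target r)
  | _, _, .self _ _ => LinearMap.id
  | _, h, .sub _ => absurd rfl h

variable (K) in
/-- The sum by which a generator other than `x` is replaced has one summand. -/
def selfEquiv {x : X} {β : Type v} (r : β → {y // y ≠ x}) (V : {y // y ≠ x} → Type t)
    [∀ y, AddCommGroup (V y)] [∀ y, Module K (V y)] {z : X} (h : z ≠ x) :
    V ⟨z, h⟩ ≃ₗ[K] ∀ m : Fiber x β z, V (m.target r) where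
  toFun n m := selfAux K r V h m n
  map_add' _ _ := funext fun m => map_add (selfAux K r V h m) _ _
  map_smul' c _ := funext fun m => map_smul (selfAux K r V h m) c _
  invFun u := u (.self z h)
  left_inv _ := rfl
  right_inv u := funext fun m => by
    obtain rfl := m.eq_self h
    rfl

variable (K) in
/-- The sum by which `x` is replaced. -/
def subEquiv {x : X} {β : Type v} (r : β → {y // y ≠ x}) (V : {y // y ≠ x} → Type t)
    [∀ y, AddCommGroup (V y)] [∀ y, Module K (V y)] :
    (∀ m : Fiber x β x, V (m.target r)) ≃ₗ[K] ∀ l, V (r l) :=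
  LinearEquiv.ofBijective
    { toFun := fun u l => u (.sub l)
      map_add' := fun _ _ => rfl
      map_smul' := fun _ _ => rfl } <| by
    refine ⟨fun u u' h => funext fun m => ?_, fun n => ?_⟩
    · obtain ⟨l, rfl⟩ := m.exists_eq_sub
      exact congrFun h l
    · have H : ∀ {z} (m : Fiber x β z), z = x → ∃ n' : V (m.target r),
          ∀ l, HEq m (Fiber.sub (x := x) l) → HEq n' (n l) := by
        intro z m hz
        cases m with
        | self z h => exact absurd hz h
        | sub l => exact ⟨n l, fun l' h => by cases h; rfl⟩
      choose u hu using fun m : Fiber x β x => H m rfl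
      exact ⟨u, funext fun l => eq_of_heq (hu _ l HEq.rfl)⟩

variable (N : Rep.{u, v, w, max v t} K (collapseLeft hq) (collapseRight hq))

/-- The module which corresponds to the generator `z` in the representation `Rep.extend`. -/
abbrev extendV (z : X) : Type max v t :=
  ∀ m : Fiber (p i default) (κ i) z, N.V (m.target fun l => ⟨q i l, hq l⟩)

/-- The isomorphism given by the relation by which the representation is extended. -/
def extendIso : (∀ k, extendV hq N (p i k)) ≃ₗ[K] ∀ l, extendV hq N (q i l) :=
  LinearEquiv.piUnique K (fun k => extendV hq N (p i k)) ≪≫ₗ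
    subEquiv K (fun l => ⟨q i l, hq l⟩) N.V ≪≫ₗ
      LinearEquiv.piCongrRight fun l => selfEquiv K (fun l => ⟨q i l, hq l⟩) N.V (hq l)

/-- Currying. -/
def curryEquiv {α : Type v} (f : α → X) :
    (∀ k, extendV hq N (f k)) ≃ₗ[K]
      ∀ m : Σ k, Fiber (p i default) (κ i) (f k), N.V (Fiber.word (fun l => ⟨q i l, hq l⟩) f m) where
  toFun u m := u m.1 m.2
  map_add' _ _ := rfl
  map_smul' _ _ := rfl
  invFun u k m := u ⟨k, m⟩
  left_inv _ := rfl
  right_inv _ := rfl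

open Classical in
/-- A representation whose collapse is isomorphic to `N`. -/
def extend : Rep.{u, v, w, max v t} K p q where
  V := extendV hq N
  iso j := if h : i = j then h ▸ extendIso hq N else
    curryEquiv hq N (p j) ≪≫ₗ N.iso ⟨j, Ne.symm h⟩ ≪≫ₗ (curryEquiv hq N (q j)).symm

theorem extend_iso_self : (extend hq N).iso i = extendIso hq N := dif_pos rfl

theorem extend_iso (j : {j // j ≠ i}) : (extend hq N).iso j =
    curryEquiv hq N (p j) ≪≫ₗ N.iso j ≪≫ₗ (curryEquiv hq N (q j)).symm :=
  dif_neg j.2.symm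

theorem expandAux_extend {z : X} (m : Fiber (p i default) (κ i) z) (n : (extend hq N).V z) :
    (extend hq N).expandAux hq m n =
      selfEquiv K (fun l => ⟨q i l, hq l⟩) N.V (m.target fun l => ⟨q i l, hq l⟩).2 (n m) := by
  cases m with
  | self z h =>
    obtain ⟨n, rfl⟩ := (selfEquiv K (fun l => ⟨q i l, hq l⟩) N.V h).surjective n
    rfl
  | sub l =>
    obtain ⟨v, rfl⟩ :=
      (LinearEquiv.piUnique K fun k => (extend hq N).V (p i k)).surjective n
    refine (expandAux_sub hq (extend hq N) l v).trans ?_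
    rw [extend_iso_self]
    rfl

theorem collapse_essSurj : (collapse.{u, v, w, max v t} K hq).EssSurj where
  mem_essImage N := by
    let R := extend hq N
    let θ : ∀ y : {y // y ≠ p i default}, N.V y →ₗ[K] R.V y.1 := fun y =>
      (selfEquiv K (fun l => ⟨q i l, hq l⟩) N.V y.2).toLinearMap
    have hθ : ∀ {α : Type v} (f : α → X) (u : ∀ k, R.V (f k)),
        (fun m => θ _ (curryEquiv hq N f u m)) = R.expandWord hq f u := fun f u =>
      funext fun m => (expandAux_extend hq N m.2 (u m.1)).symm
    let φ : N ⟶ (collapse K hq).obj R := ⟨θ, fun j v l => by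
      obtain ⟨u, rfl⟩ := (curryEquiv hq N (p j)).surjective v
      have h := collapse_iso hq R j u
      refine (congrFun (congrArg (((collapse K hq).obj R).iso j) (hθ (p j) u)) l).trans ?_
      refine (congrFun h l).trans ?_
      rw [← hθ]
      refine congrArg (θ _) ?_
      rw [extend_iso]
      rfl⟩
    have := isIso_of_bijective φ fun y =>
      (selfEquiv K (fun l => ⟨q i l, hq l⟩) N.V y.2).bijective
    exact ⟨R, ⟨(asIso φ).symm⟩⟩

theorem collapse_isEquivalence : (collapse.{u, v, w, max v t} K hq).IsEquivalence where
  essSurj := collapse_essSurj hq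

end Extend

end Rep

/-! ### Morita equivalence -/

theorem isMoritaEquivalent_of_isUniversal {K : Type u} [Field K] {X : Type v} [Fintype X]
    {I : Type w} {ι κ : I → Type v} [∀ j, Fintype (ι j)] [∀ j, Fintype (κ j)]
    {p : ∀ j, ι j → X} {q : ∀ j, κ j → X} {i : I} [Unique (ι i)] {x : X} (hx : x = p i default)
    [Fintype {y // y ≠ x}] (hq : ∀ l, q i l ≠ x)
    [∀ j, Fintype (Σ k, Fiber x (κ i) (p j k))] [∀ j, Fintype (Σ k, Fiber x (κ i) (q j k))]
    {B B' : Type max u v w} [Ring B] [Algebra K B] [Ring B'] [Algebra K B']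
    {D : IsoSystem p q B} (hD : D.IsUniversal K)
    {D' : IsoSystem (fun j : {j // j ≠ i} => Fiber.word (fun l => ⟨q i l, hq l⟩) (p j))
      (fun j : {j // j ≠ i} => Fiber.word (fun l => ⟨q i l, hq l⟩) (q j)) B'}
    (hD' : D'.IsUniversal K) : IsMoritaEquivalent K B' B := by
  subst hx
  have h1 := hD.isEquivalence
  have h2 := hD'.isEquivalence
  have h3 : (Rep.collapse.{u, v, w, max u v w} K hq).IsEquivalence :=
    Rep.collapse_isEquivalence.{u, v, w, max u v w} hq
  let F := D.toRep.{u, v, w, max u v w} K ⋙ Rep.collapse.{u, v, w, max u v w} K hq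
  let G := D'.toRep.{u, v, w, max u v w} K
  have : F.asEquivalence.functor.Linear K := inferInstanceAs (F.Linear K)
  have : G.asEquivalence.functor.Linear K := inferInstanceAs (G.Linear K)
  have : G.asEquivalence.symm.functor.Linear K := G.asEquivalence.inverseLinear K
  exact IsMoritaEquivalent.symm K ⟨⟨
    { eqv := F.asEquivalence.trans G.asEquivalence.symm
      linear := inferInstanceAs
        ((F.asEquivalence.functor ⋙ G.asEquivalence.symm.functor).Linear K) }⟩⟩

section Words

variable {X : Type v} {x : X} {b : X →₀ ℕ}

theorem ne_of_fin (hb : b x = 0) (l : Σ y, Fin (b y)) : l.1 ≠ x := fun h => by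
  have := l.2.pos
  rw [h, hb] at this
  exact this.false

/-- The map which underlies `fiberEquiv`. -/
def fiberAux (hb : b x = 0) (c : X →₀ ℕ) : ∀ {z : X}, Fiber x (Σ y, Fin (b y)) z → Fin (c z) →
    Σ y : {y // y ≠ x}, Fin (c y) ⊕ Fin (c x) × Fin (b y)
  | _, .self z h, k => ⟨⟨z, h⟩, .inl k⟩
  | _, .sub l, k => ⟨⟨l.1, ne_of_fin hb l⟩, .inr (k, l.2)⟩

/-- The summands of the result of a replacement. -/
def fiberEquiv (hb : b x = 0) (c : X →₀ ℕ) :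
    (Σ k : (Σ y, Fin (c y)), Fiber x (Σ y, Fin (b y)) k.1) ≃
      Σ y : {y // y ≠ x}, Fin (c y) ⊕ Fin (c x) × Fin (b y) where
  toFun m := fiberAux hb c m.2 m.1.2
  invFun
    | ⟨y, .inl k⟩ => ⟨⟨y.1, k⟩, .self y.1 y.2⟩
    | ⟨y, .inr (k, l)⟩ => ⟨⟨x, k⟩, .sub ⟨y.1, l⟩⟩
  left_inv := by
    rintro ⟨⟨_, k⟩, ⟨z, h⟩ | l⟩ <;> rfl
  right_inv := by
    rintro ⟨y, k | ⟨k, l⟩⟩ <;> rfl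

variable [DecidableEq X]

/-- The summands of `collapseSum x b c`. -/
def collapseSumEquiv (hb : b x = 0) (c : X →₀ ℕ) :
    (Σ k : (Σ y, Fin (c y)), Fiber x (Σ y, Fin (b y)) k.1) ≃
      Σ y : {y // y ≠ x}, Fin (collapseSum x b c y) :=
  (fiberEquiv hb c).trans <| Equiv.sigmaCongrRight fun y =>
    ((Equiv.sumCongr (Equiv.refl _) finProdFinEquiv).trans finSumFinEquiv).trans
      (finCongr (substitute_apply_of_ne x b c y.2).symm)

theorem collapseSumEquiv_fst (hb : b x = 0) (c : X →₀ ℕ)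
    (m : Σ k : (Σ y, Fin (c y)), Fiber x (Σ y, Fin (b y)) k.1) :
    (collapseSumEquiv hb c m).1 =
      Fiber.word (fun l : Σ y, Fin (b y) => ⟨l.1, ne_of_fin hb l⟩) Sigma.fst m := by
  obtain ⟨⟨_, k⟩, ⟨z, h⟩ | l⟩ := m <;> rfl

end Words

namespace BergmanPresentation

variable {X : Type v} {I : Type w} [DecidableEq X]

theorem isBasic_collapse (P : BergmanPresentation X I) (hP : P.IsBasic) (x : X) (i : I)
    (hx : P.b i x = 0) : (P.collapse hP x i hx).IsBasic := by
  refine Set.eq_univ_of_forall fun y j hj => ?_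
  have : j.1 ∈ P.blue := hj
  simp [hP.blue_eq_empty] at this

theorem isMoritaEquivalent_collapse (K : Type u) [Field K] [Fintype X]
    (P : BergmanPresentation X I) (hP : P.IsBasic) (x : X) (i : I)
    (hi : P.a i = Finsupp.single x 1) (hx : P.b i x = 0) :
    IsMoritaEquivalent K ((P.collapse hP x i hx).algebra K) (P.algebra K) := by
  have hix : P.a i x = 1 := by simp [hi]
  let _ : Unique (Σ y, Fin (P.a i y)) :=
    { default := ⟨x, ⟨0, by simp [hix]⟩⟩
      uniq := by
        rintro ⟨y, k⟩
        obtain rfl : x = y := by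
          by_contra h
          have := k.pos
          simp [hi, h] at this
        have : Subsingleton (Fin (P.a i x)) := by
          rw [hix]
          infer_instance
        rw [Subsingleton.elim k] }
  obtain ⟨D, hD⟩ := hP.exists_isUniversal K (fun j (k : Σ y, Fin (P.a j y)) => k.1)
    (fun j (k : Σ y, Fin (P.b j y)) => k.1) (fun _ => Equiv.refl _) (fun _ _ => rfl)
    (fun _ => Equiv.refl _) (fun _ _ => rfl)
  let _ (c : X →₀ ℕ) : Fintype (Σ k : (Σ y, Fin (c y)), Fiber x (Σ y, Fin (P.b i y)) k.1) :=
    Fintype.ofEquiv _ (collapseSumEquiv hx c).symm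
  refine Exists.elim ((P.isBasic_collapse hP x i hx).exists_isUniversal K
    (fun j => Fiber.word (fun l => ⟨l.1, ne_of_fin hx l⟩) Sigma.fst)
    (fun j => Fiber.word (fun l => ⟨l.1, ne_of_fin hx l⟩) Sigma.fst)
    (fun j => collapseSumEquiv hx (P.a j)) (fun j => collapseSumEquiv_fst hx (P.a j))
    (fun j => collapseSumEquiv hx (P.b j)) (fun j => collapseSumEquiv_fst hx (P.b j)))
    fun D' hD' => ?_
  exact isMoritaEquivalent_of_isUniversal (i := i) (x := x) rfl (ne_of_fin hx) hD hD'

end BergmanPresentation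

namespace BergmanGraph

variable {V : Type v} {E : Type w}

theorem isBasic_collapse (H : BergmanGraph V E) (hH : H.IsBasic) (v : V) (h : E)
    (hv : H.r h v = 0) : (H.collapse hH v h hv).IsBasic := by
  refine Set.eq_univ_of_forall fun y g hg => ?_
  have : g.1 ∈ H.blue := hg
  simp [hH.blue_eq_empty] at this

theorem toPresentation_isBasic [Fintype V] {H : BergmanGraph V E} (hH : H.IsBasic) :
    H.toPresentation.IsBasic := hH

theorem toPresentation_collapse [Fintype V] [DecidableEq V] (H : BergmanGraph V E)
    (hH : H.IsBasic) (v : V) (h : E) (hv : H.r h v = 0) : (H.collapse hH v h hv).toPresentation =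
      H.toPresentation.collapse (toPresentation_isBasic hH) v h hv := by
  have key : ∀ (m n : V → ℕ), Finsupp.equivFunOnFinite.symm
      (fun u : {u : V // u ≠ v} => n u + n v * m u) = collapseSum v
        (Finsupp.equivFunOnFinite.symm m) (Finsupp.equivFunOnFinite.symm n) := fun m n =>
    Finsupp.ext fun u => (substitute_apply_of_ne v (Finsupp.equivFunOnFinite.symm m)
      (Finsupp.equivFunOnFinite.symm n) u.2).symm
  simp only [toPresentation, collapse, BergmanPresentation.collapse, key]

end BergmanGraph

end Bergman

end

theorem mainTheorem4 (K : Type u) [Field K] :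
    (∀ (X : Type v) (I : Type w) [Fintype X] [DecidableEq X] [Finite I]
      (P : Bergman.BergmanPresentation X I), ∀ (hP : P.IsBasic)
      (x : X) (i : I), P.a i = Finsupp.single x 1 → ∀ hx : P.b i x = 0,
        (P.collapse hP x i hx).IsBasic ∧
          IsMoritaEquivalent K ((P.collapse hP x i hx).algebra K) (P.algebra K)) ∧
    (∀ (V : Type v) (E : Type w) [Fintype V] [DecidableEq V] [Finite E]
      (H : Bergman.BergmanGraph V E), ∀ (hH : H.IsBasic)
      (v : V) (h : E), H.s h = Pi.single v 1 → ∀ hv : H.r h v = 0,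
        (H.collapse hH v h hv).IsBasic ∧
          IsMoritaEquivalent K ((H.collapse hH v h hv).algebra K) (H.algebra K)) := by
  refine ⟨fun X I _ _ _ P hP x i hi hx => ⟨P.isBasic_collapse hP x i hx,
    P.isMoritaEquivalent_collapse K hP x i hi hx⟩, fun V E _ _ _ H hH v h hs hv =>
      ⟨H.isBasic_collapse hH v h hv, ?_⟩⟩
  unfold Bergman.BergmanGraph.algebra
  rw [H.toPresentation_collapse hH v h hv]
  refine H.toPresentation.isMoritaEquivalent_collapse K
    (Bergman.BergmanGraph.toPresentation_isBasic hH) v h (Finsupp.ext fun u => ?_) hv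
  simp only [Bergman.BergmanGraph.toPresentation, Finsupp.equivFunOnFinite_symm_apply_apply, hs,
    Pi.single_apply, Finsupp.single_apply, eq_comm]
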